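/- **Soundness of algorithmic subtyping** (bidirectional typing with universal and existential quantifiers, indexed types, equational constraints). *Syntax.* Sorts are $\kappa ::= \star \mid \mathbb{N}$. Terms/monotypes are $s,t,\tau ::= 1 \mid \alpha \mid \hat\alpha \mid \tau\oplus\tau \mid \mathsf{zero} \mid \mathsf{succ}(t)$ with $\oplus\in\{\to,+,\times\}$, where $\alpha$ ranges over universal and $\hat\alpha$ over existential variables. Propositions are equations $P ::= (s=t)$ between terms of sort $\mathbb N$. Types are $A,B ::= 1 \mid \alpha \mid \hat\alpha \mid A\oplus B \mid \forall\alpha{:}\kappa.\,A \mid \exists\alpha{:}\kappa.\,A \mid P\supset A \mid A\wedge P \mid \mathsf{Vec}\,t\,A$, up to renaming of bound variables. A type is *negative* if it is headed by $\forall$ and *positive* if it is headed by $\exists$; polarities are $\pm\in\{+,-\}$. *Contexts.* An algorithmic context $\Gamma$ is a list of entries $x{:}A\,p$ (with principality $p\in\{!,\not!\}$), $\alpha{:}\kappa$, $\hat\alpha{:}\kappa$ (unsolved), $\hat\alpha{:}\kappa=t$ (solved), $\alpha=t$ (equation), and markers $\blacktriangleright_\alpha,\blacktriangleright_{\hat\alpha},\blacktriangleright_P$.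 It is *complete* if it has no unsolved $\hat\alpha$. Contexts applied as substitutions: $[\Gamma,\hat\alpha{:}\kappa=t]A=[[\Gamma]t/\hat\alpha]([\Gamma]A)$, $[\Gamma,\alpha=t]A=[[\Gamma]t/\alpha]([\Gamma]A)$, and all other entries are ignored. $\Gamma$ is *well-formed* if no variable is declared twice, no marker $\blacktriangleright_\alpha$ or $\blacktriangleright_{\hat\alpha}$ is repeated, and each entry is well-formed over the prefix $\Gamma_0$ to its left: types and solutions are well-formed, respectively well-sorted; for $x{:}A\,!$ the type $[\Gamma_0]A$ has no existential variables; for $\alpha=t$ the variable $\alpha$ is declared in $\Gamma_0$, $t$ has its sort, $\Gamma_0$ has no equation for $\alpha$, and $\alpha\notin FV([\Gamma_0]t)$. *Extension* $\Gamma\longrightarrow\Delta$ is generated by: $\cdot\longrightarrow\cdot$; and, if $\Gamma\longrightarrow\Delta$, then $\Gamma,x{:}A\,p\longrightarrow\Delta,x{:}A'p$ when $[\Delta]A=[\Delta]A'$; $\Gamma,e\longrightarrow\Delta,e$ for $e$ a declaration $\alpha{:}\kappa$, an unsolved $\hat\alpha{:}\kappa$, or a marker; $\Gamma,\hat\alpha{:}\kappa=t\longrightarrow\Delta,\hat\alpha{:}\kappa=t'$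 and $\Gamma,\alpha=t\longrightarrow\Delta,\alpha=t'$ when $[\Delta]t=[\Delta]t'$; $\Gamma,\hat\alpha{:}\kappa\longrightarrow\Delta,\hat\alpha{:}\kappa=t$; $\Gamma\longrightarrow\Delta,\hat\alpha{:}\kappa$; $\Gamma\longrightarrow\Delta,\hat\alpha{:}\kappa=t$. *Applying a complete context $\Omega$ to $\Delta$* gives a declarative context (a list of entries $x{:}A\,p$ and $\alpha{:}\kappa$), by a partial operation: $[\cdot]\cdot=\cdot$; $[\Omega,x{:}A\,p](\Delta,x{:}A'p)=[\Omega]\Delta,x{:}[\Omega]A\,p$ if $[\Omega]A=[\Omega]A'$; $[\Omega,\alpha{:}\kappa](\Delta,\alpha{:}\kappa)=[\Omega]\Delta,\alpha{:}\kappa$; $[\Omega,\blacktriangleright](\Delta,\blacktriangleright)=[\Omega]\Delta$; $[\Omega,\alpha=t](\Delta,\alpha=t')=[[\Omega]t/\alpha]([\Omega]\Delta)$ if $[\Omega]t=[\Omega]t'$, where $[t/\alpha](\Psi_0,\alpha{:}\kappa,\Psi_1)=\Psi_0,[t/\alpha]\Psi_1$; $[\Omega,\hat\alpha{:}\kappa=t]\Delta=[\Omega]\Delta_0$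 if $\Delta=(\Delta_0,\hat\alpha{:}\kappa)$ or $\Delta=(\Delta_0,\hat\alpha{:}\kappa=t')$, and $=[\Omega]\Delta$ otherwise. *Declarative subtyping* $\Psi\vdash A\le^{\pm}B$ is generated by: $\Psi\vdash A\le^{\pm}A$ if $\Psi\vdash A\ \mathit{type}$ and $A$ is neither positive nor negative; $\Psi\vdash A\le^{+}B$ if $\Psi\vdash A\le^{-}B$ and neither $A$ nor $B$ is positive; $\Psi\vdash A\le^{-}B$ if $\Psi\vdash A\le^{+}B$ and neither is negative; $\Psi\vdash\forall\alpha{:}\kappa.A\le^{-}B$ if $\Psi\vdash\tau:\kappa$ and $\Psi\vdash[\tau/\alpha]A\le^{-}B$; $\Psi\vdash A\le^{-}\forall\beta{:}\kappa.B$ if $\Psi,\beta{:}\kappa\vdash A\le^{-}B$; $\Psi\vdash\exists\alpha{:}\kappa.A\le^{+}B$ if $\Psi,\alpha{:}\kappa\vdash A\le^{+}B$; $\Psi\vdash A\le^{+}\exists\beta{:}\kappa.B$ if $\Psi\vdash\tau:\kappa$ and $\Psi\vdash A\le^{+}[\tau/\beta]B$ (variables added to $\Psi$ are fresh). *Algorithmic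 judgments.* (Newly introduced variables are fresh.) Instantiation $\Gamma\vdash\hat\alpha:=t:\kappa\dashv\Delta$: - $\Gamma_0,\hat\alpha{:}\kappa,\Gamma_1\vdash\hat\alpha:=\tau:\kappa\dashv\Gamma_0,\hat\alpha{:}\kappa=\tau,\Gamma_1$ if $\Gamma_0\vdash\tau:\kappa$; - $\Gamma_0,\hat\alpha{:}\kappa,\Gamma_1,\hat\beta{:}\kappa,\Gamma_2\vdash\hat\alpha:=\hat\beta:\kappa\dashv\Gamma_0,\hat\alpha{:}\kappa,\Gamma_1,\hat\beta{:}\kappa=\hat\alpha,\Gamma_2$; - $\Gamma_0,\hat\alpha{:}\star,\Gamma_1\vdash\hat\alpha:=\tau_1\oplus\tau_2:\star\dashv\Delta$ if $\Gamma_0,\hat\alpha_2{:}\star,\hat\alpha_1{:}\star,\hat\alpha{:}\star=\hat\alpha_1\oplus\hat\alpha_2,\Gamma_1\vdash\hat\alpha_1:=\tau_1:\star\dashv\Theta$ and $\Theta\vdash\hat\alpha_2:=[\Theta]\tau_2:\star\dashv\Delta$; - $\Gamma_0,\hat\alpha{:}\mathbb N,\Gamma_1\vdash\hat\alpha:=\mathsf{zero}:\mathbb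 N\dashv\Gamma_0,\hat\alpha{:}\mathbb N=\mathsf{zero},\Gamma_1$; - $\Gamma_0,\hat\alpha{:}\mathbb N,\Gamma_1\vdash\hat\alpha:=\mathsf{succ}(t):\mathbb N\dashv\Delta$ if $\Gamma_0,\hat\alpha_1{:}\mathbb N,\hat\alpha{:}\mathbb N=\mathsf{succ}(\hat\alpha_1),\Gamma_1\vdash\hat\alpha_1:=t:\mathbb N\dashv\Delta$. Equation checking $\Gamma\vdash s\doteq t:\kappa\dashv\Delta$: reflexivity (with $\Delta=\Gamma$) on a universal or existential variable, on $1$ (at $\star$), and on $\mathsf{zero}$ (at $\mathbb N$); congruence for $\mathsf{succ}$; congruence for $\oplus$ (first components from $\Gamma$ to some $\Theta$, then the second components, after applying $[\Theta]$, from $\Theta$ to $\Delta$); and if $\hat\alpha\notin FV(t)$ and $\Gamma\vdash\hat\alpha:=t:\kappa\dashv\Delta$, then $\Gamma\vdash\hat\alpha\doteq t:\kappa\dashv\Delta$ and $\Gamma\vdash t\doteq\hat\alpha:\kappa\dashv\Delta$. Propositions: $\Gamma\vdash(\sigma_1=\sigma_2)\equiv(t_1=t_2)\dashv\Delta$ if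 $\Gamma\vdash\sigma_1\doteq t_1:\mathbb N\dashv\Theta$ and $\Theta\vdash[\Theta]\sigma_2\doteq[\Theta]t_2:\mathbb N\dashv\Delta$. Type equivalence $\Gamma\vdash A\equiv B\dashv\Delta$: reflexivity on $\alpha,\hat\alpha,1$; congruence, with contexts threaded in the same way, for $\oplus$, $\mathsf{Vec}$ (index first), $P\supset A$ and $A\wedge P$ (proposition first); congruence for $\forall\alpha{:}\kappa$ and $\exists\alpha{:}\kappa$ (the bodies are compared in $\Gamma,\alpha{:}\kappa$ with output $\Delta,\alpha{:}\kappa,\Delta'$); and if $\hat\alpha\notin FV(\tau)$ and $\Gamma\vdash\hat\alpha:=\tau:\star\dashv\Delta$, then $\Gamma\vdash\hat\alpha\equiv\tau\dashv\Delta$ and $\Gamma\vdash\tau\equiv\hat\alpha\dashv\Delta$. Algorithmic subtyping $\Gamma\vdash A<:^{\pm}B\dashv\Delta$: - $\Gamma\vdash A<:^{\pm}B\dashv\Delta$ if neither $A$ nor $B$ is headed by a quantifier and $\Gamma\vdash A\equiv B\dashv\Delta$; - $\Gamma\vdash\forall\alpha{:}\kappa.A<:^-B\dashv\Delta$ if $B$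 is not negative and $\Gamma,\blacktriangleright_{\hat\alpha},\hat\alpha{:}\kappa\vdash[\hat\alpha/\alpha]A<:^-B\dashv\Delta,\blacktriangleright_{\hat\alpha},\Theta$; - $\Gamma\vdash A<:^-\forall\beta{:}\kappa.B\dashv\Delta$ if $\Gamma,\beta{:}\kappa\vdash A<:^-B\dashv\Delta,\beta{:}\kappa,\Theta$; - $\Gamma\vdash\exists\alpha{:}\kappa.A<:^+B\dashv\Delta$ if $\Gamma,\alpha{:}\kappa\vdash A<:^+B\dashv\Delta,\alpha{:}\kappa,\Theta$; - $\Gamma\vdash A<:^+\exists\beta{:}\kappa.B\dashv\Delta$ if $A$ is not positive and $\Gamma,\blacktriangleright_{\hat\beta},\hat\beta{:}\kappa\vdash A<:^+[\hat\beta/\beta]B\dashv\Delta,\blacktriangleright_{\hat\beta},\Theta$; - $\Gamma\vdash A<:^+B\dashv\Delta$ if $\Gamma\vdash A<:^-B\dashv\Delta$, one of $A,B$ is negative and the other is not positive; - $\Gamma\vdash A<:^-B\dashv\Delta$ if $\Gamma\vdash A<:^+B\dashv\Delta$, one of $A,B$ is positive and the other is not negative. **Theorem.** Let $\Gamma,\Delta,\Omega$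 be well-formed algorithmic contexts, with $\Omega$ complete, and let $\pm$ be a polarity. If $\Gamma\vdash A\ \mathit{type}$, $\Gamma\vdash B\ \mathit{type}$, $[\Gamma]A=A$, $[\Gamma]B=B$, $\Gamma\vdash A<:^{\pm}B\dashv\Delta$ and $\Delta\longrightarrow\Omega$, then $[\Omega]\Delta$ is defined and $$[\Omega]\Delta\vdash[\Omega]A\le^{\pm}[\Omega]B .$$ -/

import Mathlib

/-!
# Higher-rank polymorphism with existentials and indexed types: subtyping

Bound variables are de Bruijn indices (locally nameless style), so that equality of types is equality
up to renaming of bound variables.  Free universal variables, free existential variables and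
expression variables are named by natural numbers, in three separate name spaces.
-/

namespace BidirSub

/-! ## Syntax -/

/-- Sorts: `star` is the sort of monotypes, `nat` the sort of natural numbers (indices). -/
inductive Srt where
  | star
  | nat
  deriving DecidableEq

/-- Binary connectives: functions, sums and products. -/
inductive BinOp where
  | arrow
  | sum
  | prod
  deriving DecidableEq

/-- Principalities of assumptions: `principal` is `!`. -/
inductive Principality where
  | principal
  | nonprincipal
  deriving DecidableEq

/-- Subtyping polarities. -/
inductive Polarity where
  | pos
  | neg

/-- Type-level expressions.  Types and index terms / monotypes share one raw syntax; the judgments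
`Sorting` (for terms, that is, monotypes and indices) and `TypeWf` (for types) single out the two
grammatical classes.  A proposition is an equation `s = t` between terms; it occurs in
`imp s t A`, which is `(s = t) ⊃ A`, and in `conj A s t`, which is `A ∧ (s = t)`. -/
inductive Ty where
  | bvar (i : ℕ)
  | uvar (α : ℕ)
  | evar (a : ℕ)
  | unit
  | bin (op : BinOp) (A B : Ty)
  | zero
  | succ (t : Ty)
  | all (κ : Srt) (A : Ty)
  | ex (κ : Srt) (A : Ty)
  | imp (s t : Ty) (A : Ty)
  | conj (A : Ty) (s t : Ty)
  | vec (t : Ty) (A : Ty)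
  deriving DecidableEq

namespace Ty

/-- `inst k u A` replaces the bound variable with index `k` by the locally closed `u` in `A`. -/
def inst : ℕ → Ty → Ty → Ty
  | k, u, bvar i => if i = k then u else bvar i
  | _, _, uvar α => uvar α
  | _, _, evar a => evar a
  | _, _, unit => unit
  | k, u, bin op A B => bin op (inst k u A) (inst k u B)
  | _, _, zero => zero
  | k, u, succ t => succ (inst k u t)
  | k, u, all κ A => all κ (inst (k + 1) u A)
  | k, u, ex κ A => ex κ (inst (k + 1) u A)
  | k, u, imp s t A => imp (inst k u s) (inst k u t) (inst k u A)
  | k, u, conj A s t => conj (inst k u A) (inst k u s) (inst k u t)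
  | k, u, vec t A => vec (inst k u t) (inst k u A)

/-- `A.opn u` is `[u/α]A`, where `A` is the body of a quantifier that binds `α`. -/
def opn (A u : Ty) : Ty := inst 0 u A

/-- `substU α u A` is `[u/α]A`, for a free universal variable `α`. -/
def substU (α : ℕ) (u : Ty) : Ty → Ty
  | bvar i => bvar i
  | uvar β => if β = α then u else uvar β
  | evar a => evar a
  | unit => unit
  | bin op A B => bin op (substU α u A) (substU α u B)
  | zero => zero
  | succ t => succ (substU α u t)
  | all κ A => all κ (substU α u A)
  | ex κ A => ex κ (substU α u A)
  | imp s t A => imp (substU α u s) (substU α u t) (substU α u A)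
  | conj A s t => conj (substU α u A) (substU α u s) (substU α u t)
  | vec t A => vec (substU α u t) (substU α u A)

/-- `substE a u A` is `[u/a]A`, for an existential variable `a`. -/
def substE (a : ℕ) (u : Ty) : Ty → Ty
  | bvar i => bvar i
  | uvar β => uvar β
  | evar b => if b = a then u else evar b
  | unit => unit
  | bin op A B => bin op (substE a u A) (substE a u B)
  | zero => zero
  | succ t => succ (substE a u t)
  | all κ A => all κ (substE a u A)
  | ex κ A => ex κ (substE a u A)
  | imp s t A => imp (substE a u s) (substE a u t) (substE a u A)
  | conj A s t => conj (substE a u A) (substE a u s) (substE a u t)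
  | vec t A => vec (substE a u t) (substE a u A)

/-- The free universal variables. -/
def fuv : Ty → Finset ℕ
  | bvar _ => ∅
  | uvar α => {α}
  | evar _ => ∅
  | unit => ∅
  | bin _ A B => fuv A ∪ fuv B
  | zero => ∅
  | succ t => fuv t
  | all _ A => fuv A
  | ex _ A => fuv A
  | imp s t A => fuv s ∪ fuv t ∪ fuv A
  | conj A s t => fuv A ∪ fuv s ∪ fuv t
  | vec t A => fuv t ∪ fuv A

/-- The free existential variables. -/
def fev : Ty → Finset ℕ
  | bvar _ => ∅
  | uvar _ => ∅
  | evar a => {a}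
  | unit => ∅
  | bin _ A B => fev A ∪ fev B
  | zero => ∅
  | succ t => fev t
  | all _ A => fev A
  | ex _ A => fev A
  | imp s t A => fev s ∪ fev t ∪ fev A
  | conj A s t => fev A ∪ fev s ∪ fev t
  | vec t A => fev t ∪ fev A

/-- Negative types: those headed by a universal quantifier. -/
def IsNeg : Ty → Prop
  | all _ _ => True
  | _ => False

/-- Positive types: those headed by an existential quantifier. -/
def IsPos : Ty → Prop
  | ex _ _ => True
  | _ => False

def NonNeg (A : Ty) : Prop := ¬ A.IsNeg

def NonPos (A : Ty) : Prop := ¬ A.IsPos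

end Ty

/-! ## The declarative system -/

/-- Entries of declarative contexts: assumptions `x : A p` and declarations `α : κ`. -/
inductive DEntry where
  | hyp (x : ℕ) (A : Ty) (p : Principality)
  | uvar (α : ℕ) (κ : Srt)

/-- Declarative contexts.  The head of the list is the rightmost (most recent) entry:
`Ψ, e` is `e :: Ψ`. -/
abbrev DCtx := List DEntry

/-- `α ∈ dom(Ψ)`. -/
def DCtx.Declares (Ψ : DCtx) (α : ℕ) : Prop := ∃ κ, DEntry.uvar α κ ∈ Ψ

/-- `[t/α]Ψ`: `[t/α](Ψ₀, α:κ, Ψ₁) = (Ψ₀, [t/α]Ψ₁)`. -/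
def DCtx.subst (α : ℕ) (t : Ty) : DCtx → DCtx
  | [] => []
  | DEntry.hyp x A p :: Ψ => DEntry.hyp x (Ty.substU α t A) p :: DCtx.subst α t Ψ
  | DEntry.uvar β κ :: Ψ => if β = α then Ψ else DEntry.uvar β κ :: DCtx.subst α t Ψ

/-- Declarative sorting `Ψ ⊢ t : κ`.  The list `bs` records the sorts of the enclosing quantifiers
(innermost first), that is, the sorts of the bound variables; it is `[]` for closed judgments. -/
inductive DSorting (Ψ : DCtx) (bs : List Srt) : Ty → Srt → Prop
  | bvar {i κ} : bs[i]? = some κ → DSorting Ψ bs (.bvar i) κ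
  | uvar {α κ} : DEntry.uvar α κ ∈ Ψ → DSorting Ψ bs (.uvar α) κ
  | unit : DSorting Ψ bs .unit .star
  | bin {op τ₁ τ₂} : DSorting Ψ bs τ₁ .star → DSorting Ψ bs τ₂ .star →
      DSorting Ψ bs (.bin op τ₁ τ₂) .star
  | zero : DSorting Ψ bs .zero .nat
  | succ {t} : DSorting Ψ bs t .nat → DSorting Ψ bs (.succ t) .nat

/-- Well-formedness of propositions, `Ψ ⊢ (s = t) prop`. -/
def DPropWf (Ψ : DCtx) (bs : List Srt) (s t : Ty) : Prop :=
  DSorting Ψ bs s .nat ∧ DSorting Ψ bs t .nat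

/-- Well-formedness of types, `Ψ ⊢ A type`. -/
inductive DTypeWf (Ψ : DCtx) : List Srt → Ty → Prop
  | bvar {bs i} : bs[i]? = some .star → DTypeWf Ψ bs (.bvar i)
  | uvar {bs α} : DEntry.uvar α .star ∈ Ψ → DTypeWf Ψ bs (.uvar α)
  | unit {bs} : DTypeWf Ψ bs .unit
  | bin {bs op A B} : DTypeWf Ψ bs A → DTypeWf Ψ bs B → DTypeWf Ψ bs (.bin op A B)
  | all {bs κ A} : DTypeWf Ψ (κ :: bs) A → DTypeWf Ψ bs (.all κ A)
  | ex {bs κ A} : DTypeWf Ψ (κ :: bs) A → DTypeWf Ψ bs (.ex κ A)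
  | imp {bs s t A} : DPropWf Ψ bs s t → DTypeWf Ψ bs A → DTypeWf Ψ bs (.imp s t A)
  | conj {bs A s t} : DTypeWf Ψ bs A → DPropWf Ψ bs s t → DTypeWf Ψ bs (.conj A s t)
  | vec {bs t A} : DSorting Ψ bs t .nat → DTypeWf Ψ bs A → DTypeWf Ψ bs (.vec t A)

/-- Declarative subtyping `Ψ ⊢ A ≤^± B`. -/
inductive DSub : Polarity → DCtx → Ty → Ty → Prop
  | refl {pol Ψ A} : DTypeWf Ψ [] A → A.NonPos → A.NonNeg → DSub pol Ψ A A
  | posNeg {Ψ A B} : DSub .neg Ψ A B → A.NonPos → B.NonPos → DSub .pos Ψ A B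
  | negPos {Ψ A B} : DSub .pos Ψ A B → A.NonNeg → B.NonNeg → DSub .neg Ψ A B
  | allL {Ψ κ A B τ} : DSorting Ψ [] τ κ → DSub .neg Ψ (A.opn τ) B → DSub .neg Ψ (.all κ A) B
  | allR {Ψ κ A B β} : ¬ DCtx.Declares Ψ β → β ∉ A.fuv → β ∉ B.fuv →
      DSub .neg (.uvar β κ :: Ψ) A (B.opn (.uvar β)) → DSub .neg Ψ A (.all κ B)
  | exL {Ψ κ A B α} : ¬ DCtx.Declares Ψ α → α ∉ A.fuv → α ∉ B.fuv →
      DSub .pos (.uvar α κ :: Ψ) (A.opn (.uvar α)) B → DSub .pos Ψ (.ex κ A) B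
  | exR {Ψ κ A B τ} : DSorting Ψ [] τ κ → DSub .pos Ψ A (B.opn τ) → DSub .pos Ψ A (.ex κ B)

/-! ## Algorithmic contexts -/

/-- Scope markers: `▶α`, `▶a` for a universal or an existential variable, and `▶P` for the
proposition `P = (s = t)`. -/
inductive Marker where
  | uvar (α : ℕ)
  | evar (a : ℕ)
  | prop (s t : Ty)

/-- Entries of algorithmic contexts: `x : A p`, `α : κ`, unsolved `a : κ`, solved `a : κ = t`,
equations `α = t`, and markers. -/
inductive Entry where
  | hyp (x : ℕ) (A : Ty) (p : Principality)
  | uvar (α : ℕ) (κ : Srt)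
  | evar (a : ℕ) (κ : Srt)
  | solved (a : ℕ) (κ : Srt) (t : Ty)
  | eqn (α : ℕ) (t : Ty)
  | marker (m : Marker)

/-- Algorithmic contexts.  The head of the list is the rightmost (most recent) entry:
`Γ, e` is `e :: Γ`, and the concatenation `Γ₀, Γ₁` is `Γ₁ ++ Γ₀`. -/
abbrev Ctx := List Entry

namespace Ctx

/-- `x ∈ dom(Γ)`. -/
def DeclaresX (Γ : Ctx) (x : ℕ) : Prop := ∃ A p, Entry.hyp x A p ∈ Γ

/-- `α ∈ dom(Γ)`, for a universal variable. -/
def DeclaresU (Γ : Ctx) (α : ℕ) : Prop := ∃ κ, Entry.uvar α κ ∈ Γ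

/-- `a ∈ dom(Γ)`, for an existential variable, unsolved or solved. -/
def DeclaresE (Γ : Ctx) (a : ℕ) : Prop :=
  (∃ κ, Entry.evar a κ ∈ Γ) ∨ ∃ κ t, Entry.solved a κ t ∈ Γ

/-- The universal variable `α` is fresh for `Γ`. -/
def FreshU (Γ : Ctx) (α : ℕ) : Prop := ¬ Γ.DeclaresU α ∧ Entry.marker (.uvar α) ∉ Γ

/-- The existential variable `a` is fresh for `Γ`. -/
def FreshE (Γ : Ctx) (a : ℕ) : Prop := ¬ Γ.DeclaresE a ∧ Entry.marker (.evar a) ∉ Γ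

/-- `[Γ]A`: the context `Γ` applied to `A` as a substitution,
`[Γ, a:κ=t]A = [[Γ]t/a][Γ]A` and `[Γ, α=t]A = [[Γ]t/α][Γ]A`.  On a well-formed context this is the
substitution with `[Γ]a = [Γ]t` for each solution `a:κ=t` in `Γ`, `[Γ]α = [Γ]t` for each equation
`α=t` in `Γ`, and which leaves all other variables unchanged. -/
def apply : Ctx → Ty → Ty
  | [], A => A
  | .solved a _ t :: Γ, A => Ty.substE a (apply Γ t) (apply Γ A)
  | .eqn α t :: Γ, A => Ty.substU α (apply Γ t) (apply Γ A)
  | .hyp _ _ _ :: Γ, A => apply Γ A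
  | .uvar _ _ :: Γ, A => apply Γ A
  | .evar _ _ :: Γ, A => apply Γ A
  | .marker _ :: Γ, A => apply Γ A

/-- Complete contexts: contexts without unsolved existential variables. -/
def Complete (Ω : Ctx) : Prop := ∀ a κ, Entry.evar a κ ∉ Ω

end Ctx

/-- Sorting `Γ ⊢ t : κ`; `bs` lists the sorts of the bound variables as in `DSorting`. -/
inductive Sorting (Γ : Ctx) (bs : List Srt) : Ty → Srt → Prop
  | bvar {i κ} : bs[i]? = some κ → Sorting Γ bs (.bvar i) κ
  | uvar {α κ} : Entry.uvar α κ ∈ Γ → Sorting Γ bs (.uvar α) κ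
  | evar {a κ} : Entry.evar a κ ∈ Γ → Sorting Γ bs (.evar a) κ
  | solved {a κ t} : Entry.solved a κ t ∈ Γ → Sorting Γ bs (.evar a) κ
  | unit : Sorting Γ bs .unit .star
  | bin {op τ₁ τ₂} : Sorting Γ bs τ₁ .star → Sorting Γ bs τ₂ .star →
      Sorting Γ bs (.bin op τ₁ τ₂) .star
  | zero : Sorting Γ bs .zero .nat
  | succ {t} : Sorting Γ bs t .nat → Sorting Γ bs (.succ t) .nat

/-- Well-formedness of propositions, `Γ ⊢ (s = t) prop`. -/
def PropWf (Γ : Ctx) (bs : List Srt) (s t : Ty) : Prop :=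
  Sorting Γ bs s .nat ∧ Sorting Γ bs t .nat

/-- Well-formedness of types, `Γ ⊢ A type`. -/
inductive TypeWf (Γ : Ctx) : List Srt → Ty → Prop
  | bvar {bs i} : bs[i]? = some .star → TypeWf Γ bs (.bvar i)
  | uvar {bs α} : Entry.uvar α .star ∈ Γ → TypeWf Γ bs (.uvar α)
  | evar {bs a} : Entry.evar a .star ∈ Γ → TypeWf Γ bs (.evar a)
  | solved {bs a t} : Entry.solved a .star t ∈ Γ → TypeWf Γ bs (.evar a)
  | unit {bs} : TypeWf Γ bs .unit
  | bin {bs op A B} : TypeWf Γ bs A → TypeWf Γ bs B → TypeWf Γ bs (.bin op A B)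
  | all {bs κ A} : TypeWf Γ (κ :: bs) A → TypeWf Γ bs (.all κ A)
  | ex {bs κ A} : TypeWf Γ (κ :: bs) A → TypeWf Γ bs (.ex κ A)
  | imp {bs s t A} : PropWf Γ bs s t → TypeWf Γ bs A → TypeWf Γ bs (.imp s t A)
  | conj {bs A s t} : TypeWf Γ bs A → PropWf Γ bs s t → TypeWf Γ bs (.conj A s t)
  | vec {bs t A} : Sorting Γ bs t .nat → TypeWf Γ bs A → TypeWf Γ bs (.vec t A)

/-- Well-formedness of contexts, `Γ ctx`.  The condition `α ∉ FV([Γ]t)` on an equation `α = t` says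
that equations are not circular, so that applying a context as a substitution is meaningful. -/
inductive CtxWf : Ctx → Prop
  | empty : CtxWf []
  | hyp {Γ x A} : CtxWf Γ → ¬ Γ.DeclaresX x → TypeWf Γ [] A →
      CtxWf (.hyp x A .nonprincipal :: Γ)
  | hypPrincipal {Γ x A} : CtxWf Γ → ¬ Γ.DeclaresX x → TypeWf Γ [] A → (Γ.apply A).fev = ∅ →
      CtxWf (.hyp x A .principal :: Γ)
  | uvar {Γ α κ} : CtxWf Γ → ¬ Γ.DeclaresU α → CtxWf (.uvar α κ :: Γ)
  | evar {Γ a κ} : CtxWf Γ → ¬ Γ.DeclaresE a → CtxWf (.evar a κ :: Γ)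
  | solved {Γ a κ t} : CtxWf Γ → ¬ Γ.DeclaresE a → Sorting Γ [] t κ →
      CtxWf (.solved a κ t :: Γ)
  | eqn {Γ α κ t} : CtxWf Γ → Entry.uvar α κ ∈ Γ → (∀ t', Entry.eqn α t' ∉ Γ) →
      Sorting Γ [] t κ → α ∉ (Γ.apply t).fuv → CtxWf (.eqn α t :: Γ)
  | markerU {Γ α} : CtxWf Γ → Entry.marker (.uvar α) ∉ Γ → CtxWf (.marker (.uvar α) :: Γ)
  | markerE {Γ a} : CtxWf Γ → Entry.marker (.evar a) ∉ Γ → CtxWf (.marker (.evar a) :: Γ)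
  | markerP {Γ s t} : CtxWf Γ → CtxWf (.marker (.prop s t) :: Γ)

/-- Context extension `Γ ⟶ Δ`. -/
inductive Extends : Ctx → Ctx → Prop
  | id : Extends [] []
  | hyp {Γ Δ x A A' p} : Extends Γ Δ → Δ.apply A = Δ.apply A' →
      Extends (.hyp x A p :: Γ) (.hyp x A' p :: Δ)
  | uvar {Γ Δ α κ} : Extends Γ Δ → Extends (.uvar α κ :: Γ) (.uvar α κ :: Δ)
  | unsolved {Γ Δ a κ} : Extends Γ Δ → Extends (.evar a κ :: Γ) (.evar a κ :: Δ)
  | solved {Γ Δ a κ t t'} : Extends Γ Δ → Δ.apply t = Δ.apply t' →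
      Extends (.solved a κ t :: Γ) (.solved a κ t' :: Δ)
  | solve {Γ Δ a κ t} : Extends Γ Δ → Extends (.evar a κ :: Γ) (.solved a κ t :: Δ)
  | add {Γ Δ a κ} : Extends Γ Δ → Extends Γ (.evar a κ :: Δ)
  | addSolved {Γ Δ a κ t} : Extends Γ Δ → Extends Γ (.solved a κ t :: Δ)
  | eqn {Γ Δ α t t'} : Extends Γ Δ → Δ.apply t = Δ.apply t' →
      Extends (.eqn α t :: Γ) (.eqn α t' :: Δ)
  | marker {Γ Δ m} : Extends Γ Δ → Extends (.marker m :: Γ) (.marker m :: Δ)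

/-- `[Ω]Γ`: the complete context `Ω` applied to the context `Γ`, a partial operation whose result is
a declarative context. -/
def applyCtx : Ctx → Ctx → Option DCtx
  | [], [] => some []
  | .hyp x A p :: Ω, .hyp y A' q :: Γ =>
      if x = y ∧ p = q ∧ Ctx.apply Ω A = Ctx.apply Ω A' then
        (applyCtx Ω Γ).map (fun Ψ => .hyp x (Ctx.apply Ω A) p :: Ψ)
      else none
  | .uvar α κ :: Ω, .uvar β κ' :: Γ =>
      if α = β ∧ κ = κ' then (applyCtx Ω Γ).map (fun Ψ => .uvar α κ :: Ψ) else none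
  | .eqn α t :: Ω, .eqn β t' :: Γ =>
      if α = β ∧ Ctx.apply Ω t = Ctx.apply Ω t' then
        (applyCtx Ω Γ).map (fun Ψ => DCtx.subst α (Ctx.apply Ω t) Ψ)
      else none
  | .marker (.uvar α) :: Ω, .marker (.uvar β) :: Γ => if α = β then applyCtx Ω Γ else none
  | .marker (.evar a) :: Ω, .marker (.evar b) :: Γ => if a = b then applyCtx Ω Γ else none
  | .marker (.prop s t) :: Ω, .marker (.prop s' t') :: Γ =>
      if s = s' ∧ t = t' then applyCtx Ω Γ else none
  | .solved a κ _ :: Ω, .solved b κ' t' :: Γ =>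
      if a = b ∧ κ = κ' then applyCtx Ω Γ else applyCtx Ω (.solved b κ' t' :: Γ)
  | .solved a κ _ :: Ω, .evar b κ' :: Γ =>
      if a = b ∧ κ = κ' then applyCtx Ω Γ else applyCtx Ω (.evar b κ' :: Γ)
  | .solved _ _ _ :: Ω, Γ => applyCtx Ω Γ
  | _, _ => none

/-! ## The algorithm -/

/-- Instantiation `Γ ⊢ a := t : κ ⊣ Δ`. -/
inductive Inst : Ctx → ℕ → Ty → Srt → Ctx → Prop
  | solve {Γ₀ Γ₁ a τ κ} : Sorting Γ₀ [] τ κ →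
      Inst (Γ₁ ++ .evar a κ :: Γ₀) a τ κ (Γ₁ ++ .solved a κ τ :: Γ₀)
  | reach {Γ₀ Γ₁ Γ₂ a b κ} :
      Inst (Γ₂ ++ .evar b κ :: (Γ₁ ++ .evar a κ :: Γ₀)) a (.evar b) κ
        (Γ₂ ++ .solved b κ (.evar a) :: (Γ₁ ++ .evar a κ :: Γ₀))
  | bin {Γ₀ Γ₁ Θ Δ a a₁ a₂ op τ₁ τ₂} :
      Ctx.FreshE (Γ₁ ++ .evar a .star :: Γ₀) a₁ → Ctx.FreshE (Γ₁ ++ .evar a .star :: Γ₀) a₂ →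
      a₁ ≠ a₂ → a₁ ∉ (Ty.bin op τ₁ τ₂).fev → a₂ ∉ (Ty.bin op τ₁ τ₂).fev →
      Inst (Γ₁ ++ .solved a .star (.bin op (.evar a₁) (.evar a₂)) ::
          .evar a₁ .star :: .evar a₂ .star :: Γ₀) a₁ τ₁ .star Θ →
      Inst Θ a₂ (Ctx.apply Θ τ₂) .star Δ →
      Inst (Γ₁ ++ .evar a .star :: Γ₀) a (.bin op τ₁ τ₂) .star Δ
  | zero {Γ₀ Γ₁ a} :
      Inst (Γ₁ ++ .evar a .nat :: Γ₀) a .zero .nat (Γ₁ ++ .solved a .nat .zero :: Γ₀)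
  | succ {Γ₀ Γ₁ Δ a a₁ t} :
      Ctx.FreshE (Γ₁ ++ .evar a .nat :: Γ₀) a₁ → a₁ ∉ t.fev →
      Inst (Γ₁ ++ .solved a .nat (.succ (.evar a₁)) :: .evar a₁ .nat :: Γ₀) a₁ t .nat Δ →
      Inst (Γ₁ ++ .evar a .nat :: Γ₀) a (.succ t) .nat Δ

/-- Checking an equation between terms, `Γ ⊢ s ≗ t : κ ⊣ Δ`. -/
inductive CheckEq : Ctx → Ty → Ty → Srt → Ctx → Prop
  | uvar {Γ α κ} : CheckEq Γ (.uvar α) (.uvar α) κ Γ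
  | evar {Γ a κ} : CheckEq Γ (.evar a) (.evar a) κ Γ
  | unit {Γ} : CheckEq Γ .unit .unit .star Γ
  | bin {Γ Θ Δ op σ₁ σ₂ t₁ t₂} : CheckEq Γ σ₁ t₁ .star Θ →
      CheckEq Θ (Ctx.apply Θ σ₂) (Ctx.apply Θ t₂) .star Δ →
      CheckEq Γ (.bin op σ₁ σ₂) (.bin op t₁ t₂) .star Δ
  | zero {Γ} : CheckEq Γ .zero .zero .nat Γ
  | succ {Γ Δ σ t} : CheckEq Γ σ t .nat Δ → CheckEq Γ (.succ σ) (.succ t) .nat Δ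
  | instL {Γ Δ a t κ} : Inst Γ a t κ Δ → a ∉ t.fev → CheckEq Γ (.evar a) t κ Δ
  | instR {Γ Δ a t κ} : Inst Γ a t κ Δ → a ∉ t.fev → CheckEq Γ t (.evar a) κ Δ

/-- Equivalence of propositions, `Γ ⊢ (σ₁ = σ₂) ≡ (t₁ = t₂) ⊣ Δ`. -/
inductive PropEquiv : Ctx → Ty → Ty → Ty → Ty → Ctx → Prop
  | eq {Γ Θ Δ σ₁ σ₂ t₁ t₂} : CheckEq Γ σ₁ t₁ .nat Θ →
      CheckEq Θ (Ctx.apply Θ σ₂) (Ctx.apply Θ t₂) .nat Δ → PropEquiv Γ σ₁ σ₂ t₁ t₂ Δ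

/-- Equivalence of types, `Γ ⊢ A ≡ B ⊣ Δ`. -/
inductive TypeEquiv : Ctx → Ty → Ty → Ctx → Prop
  | uvar {Γ α} : TypeEquiv Γ (.uvar α) (.uvar α) Γ
  | evar {Γ a} : TypeEquiv Γ (.evar a) (.evar a) Γ
  | unit {Γ} : TypeEquiv Γ .unit .unit Γ
  | bin {Γ Θ Δ op A₁ A₂ B₁ B₂} : TypeEquiv Γ A₁ B₁ Θ →
      TypeEquiv Θ (Ctx.apply Θ A₂) (Ctx.apply Θ B₂) Δ → TypeEquiv Γ (.bin op A₁ A₂) (.bin op B₁ B₂) Δ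
  | vec {Γ Θ Δ s t A B} : CheckEq Γ s t .nat Θ →
      TypeEquiv Θ (Ctx.apply Θ A) (Ctx.apply Θ B) Δ → TypeEquiv Γ (.vec s A) (.vec t B) Δ
  | all {Γ Δ Δ' κ A B α} : Ctx.FreshU Γ α → α ∉ A.fuv → α ∉ B.fuv →
      TypeEquiv (.uvar α κ :: Γ) (A.opn (.uvar α)) (B.opn (.uvar α)) (Δ' ++ .uvar α κ :: Δ) →
      TypeEquiv Γ (.all κ A) (.all κ B) Δ
  | ex {Γ Δ Δ' κ A B α} : Ctx.FreshU Γ α → α ∉ A.fuv → α ∉ B.fuv →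
      TypeEquiv (.uvar α κ :: Γ) (A.opn (.uvar α)) (B.opn (.uvar α)) (Δ' ++ .uvar α κ :: Δ) →
      TypeEquiv Γ (.ex κ A) (.ex κ B) Δ
  | imp {Γ Θ Δ s t s' t' A B} : PropEquiv Γ s t s' t' Θ →
      TypeEquiv Θ (Ctx.apply Θ A) (Ctx.apply Θ B) Δ → TypeEquiv Γ (.imp s t A) (.imp s' t' B) Δ
  | conj {Γ Θ Δ s t s' t' A B} : PropEquiv Γ s t s' t' Θ →
      TypeEquiv Θ (Ctx.apply Θ A) (Ctx.apply Θ B) Δ → TypeEquiv Γ (.conj A s t) (.conj B s' t') Δ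
  | instL {Γ Δ a τ} : Inst Γ a τ .star Δ → a ∉ τ.fev → TypeEquiv Γ (.evar a) τ Δ
  | instR {Γ Δ a τ} : Inst Γ a τ .star Δ → a ∉ τ.fev → TypeEquiv Γ τ (.evar a) Δ

/-- Algorithmic subtyping `Γ ⊢ A <:^± B ⊣ Δ`. -/
inductive AlgSub : Polarity → Ctx → Ty → Ty → Ctx → Prop
  | equiv {pol Γ Δ A B} : A.NonPos → A.NonNeg → B.NonPos → B.NonNeg → TypeEquiv Γ A B Δ →
      AlgSub pol Γ A B Δ
  | allL {Γ Δ Θ κ A B a} : B.NonNeg → Ctx.FreshE Γ a → a ∉ A.fev → a ∉ B.fev →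
      AlgSub .neg (.evar a κ :: .marker (.evar a) :: Γ) (A.opn (.evar a)) B
        (Θ ++ .marker (.evar a) :: Δ) →
      AlgSub .neg Γ (.all κ A) B Δ
  | allR {Γ Δ Θ κ A B β} : Ctx.FreshU Γ β → β ∉ A.fuv → β ∉ B.fuv →
      AlgSub .neg (.uvar β κ :: Γ) A (B.opn (.uvar β)) (Θ ++ .uvar β κ :: Δ) →
      AlgSub .neg Γ A (.all κ B) Δ
  | exL {Γ Δ Θ κ A B α} : Ctx.FreshU Γ α → α ∉ A.fuv → α ∉ B.fuv →
      AlgSub .pos (.uvar α κ :: Γ) (A.opn (.uvar α)) B (Θ ++ .uvar α κ :: Δ) →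
      AlgSub .pos Γ (.ex κ A) B Δ
  | exR {Γ Δ Θ κ A B b} : A.NonPos → Ctx.FreshE Γ b → b ∉ A.fev → b ∉ B.fev →
      AlgSub .pos (.evar b κ :: .marker (.evar b) :: Γ) A (B.opn (.evar b))
        (Θ ++ .marker (.evar b) :: Δ) →
      AlgSub .pos Γ A (.ex κ B) Δ
  | posNegL {Γ Δ A B} : AlgSub .neg Γ A B Δ → A.IsNeg → B.NonPos → AlgSub .pos Γ A B Δ
  | posNegR {Γ Δ A B} : AlgSub .neg Γ A B Δ → A.NonPos → B.IsNeg → AlgSub .pos Γ A B Δ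
  | negPosL {Γ Δ A B} : AlgSub .pos Γ A B Δ → A.IsPos → B.NonNeg → AlgSub .neg Γ A B Δ
  | negPosR {Γ Δ A B} : AlgSub .pos Γ A B Δ → A.NonNeg → B.IsPos → AlgSub .neg Γ A B Δ

end BidirSub

open BidirSub

namespace BidirSub

/-! The proof replaces the complete context `Ω` by an arbitrary model of the output context `Δ`. A
model (`Models`) is a declarative context `Ψ` with a simultaneous substitution `σ` that sends the
variables declared in `Δ` to declarative terms of the same sort and makes every solution and
equation of `Δ` true. Soundness is proved for all models at once (`AlgSub.sound`), so a quantifier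
rule can choose a new value for its variable without any completion of contexts being constructed.

Three facts carry the induction. The algorithm only solves existential variables and inserts new
ones (`SolveExt`), so a substitution that satisfies the output satisfies every intermediate context
(`Sub.Sat.mono`). Such a substitution does not see the contexts applied along the way
(`Sub.Sat.app_apply`). Hence it makes the two sides of an instantiation, of a checked equation or of
a type equivalence literally equal (`Inst.sound`, `CheckEq.sound`, `TypeEquiv.sound`), and
declarative reflexivity applies. A universal variable is interpreted by a fresh declarative
variable. An existential variable is interpreted by its solution, or by an arbitrary closed term if
it is still unsolved (`Models.extend`); its value is the witness of the declarative rule.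

Intermediate contexts need not be well-formed: from `α, b, α = b` the algorithm may solve `b` by
`α`, which makes the equation circular. The induction therefore uses the weaker invariant `Scoped`;
satisfaction still makes sense for circular equations.

Finally, a well-formed complete `Ω` acts as a simultaneous substitution, `Ω.sub`. This is a model
over `[Ω]Δ` of every `Δ` that `Ω` extends (`Extends.exists_applyCtx`, `Extends.models`), and its
instance of soundness is the theorem. -/

/-! ## Simultaneous substitutions -/

/-- A simultaneous substitution for the free universal and existential variables. -/
structure Sub where
  u : ℕ → Ty
  e : ℕ → Ty

namespace Sub

/-- The action of a substitution on a type. -/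
def app (σ : Sub) : Ty → Ty
  | .bvar i => .bvar i
  | .uvar α => σ.u α
  | .evar a => σ.e a
  | .unit => .unit
  | .bin op A B => .bin op (app σ A) (app σ B)
  | .zero => .zero
  | .succ t => .succ (app σ t)
  | .all κ A => .all κ (app σ A)
  | .ex κ A => .ex κ (app σ A)
  | .imp s t A => .imp (app σ s) (app σ t) (app σ A)
  | .conj A s t => .conj (app σ A) (app σ s) (app σ t)
  | .vec t A => .vec (app σ t) (app σ A)

/-- Replacing a variable by a term of the same `σ`-value is invisible to `σ`; this is what makes
contexts applied as substitutions disappear. -/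
theorem app_substE {σ : Sub} {a : ℕ} {u : Ty} (h : σ.e a = σ.app u) (A : Ty) :
    σ.app (Ty.substE a u A) = σ.app A := by
  induction A with
  | evar b =>
    by_cases hb : b = a
    · subst hb; simp [Ty.substE, app, h]
    · simp [Ty.substE, app, hb]
  | _ => simp_all [Ty.substE, app]

theorem app_substU {σ : Sub} {α : ℕ} {u : Ty} (h : σ.u α = σ.app u) (A : Ty) :
    σ.app (Ty.substU α u A) = σ.app A := by
  induction A with
  | uvar b =>
    by_cases hb : b = α
    · subst hb; simp [Ty.substU, app, h]
    · simp [Ty.substU, app, hb]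
  | _ => simp_all [Ty.substU, app]

/-- The substitution agrees with `σ` except that it maps the universal variable `α` to `t`. -/
def updU (σ : Sub) (α : ℕ) (t : Ty) : Sub := ⟨Function.update σ.u α t, σ.e⟩

/-- The substitution agrees with `σ` except that it maps the existential variable `a` to `t`. -/
def updE (σ : Sub) (a : ℕ) (t : Ty) : Sub := ⟨σ.u, Function.update σ.e a t⟩

theorem app_updU {σ : Sub} {α : ℕ} {t A : Ty} (h : α ∉ A.fuv) :
    (σ.updU α t).app A = σ.app A := by
  induction A with
  | uvar β =>
    have : β ≠ α := fun hβ => h (by simp [Ty.fuv, hβ])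
    simp [app, updU, this]
  | _ => simp_all [app, Ty.fuv, updU]

end Sub

/-- Types that are locally closed and not headed by a quantifier. -/
def Ty.Plain (t : Ty) : Prop := (∀ k u, Ty.inst k u t = t) ∧ t.NonPos ∧ t.NonNeg

/-- Substitutions whose values are locally closed and not headed by a quantifier. -/
def Sub.Plain (σ : Sub) : Prop := (∀ α, (σ.u α).Plain) ∧ ∀ a, (σ.e a).Plain

theorem Ty.Plain.uvar (α : ℕ) : (Ty.uvar α).Plain :=
  ⟨fun _ _ => rfl, fun h => h, fun h => h⟩

theorem Ty.Plain.evar (a : ℕ) : (Ty.evar a).Plain :=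
  ⟨fun _ _ => rfl, fun h => h, fun h => h⟩

namespace Sub

theorem Plain.updU {σ : Sub} (hσ : σ.Plain) {α : ℕ} {t : Ty} (ht : t.Plain) :
    (σ.updU α t).Plain := by
  refine ⟨fun β => ?_, hσ.2⟩
  by_cases hβ : β = α
  · subst hβ; simpa [Sub.updU] using ht
  · simpa [Sub.updU, hβ] using hσ.1 β

theorem Plain.updE {σ : Sub} (hσ : σ.Plain) {a : ℕ} {t : Ty} (ht : t.Plain) :
    (σ.updE a t).Plain := by
  refine ⟨hσ.1, fun b => ?_⟩
  by_cases hb : b = a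
  · subst hb; simpa [Sub.updE] using ht
  · simpa [Sub.updE, hb] using hσ.2 b

/-- The values of `σ` are locally closed, so instantiation does not act inside them, at any depth.
-/
theorem Plain.app_inst {σ : Sub} (hσ : σ.Plain) (A u : Ty) (k : ℕ) :
    σ.app (Ty.inst k u A) = Ty.inst k (σ.app u) (σ.app A) := by
  induction A generalizing k with
  | bvar i =>
    by_cases hi : i = k <;> simp [Ty.inst, app, hi]
  | uvar α => simp [Ty.inst, app, (hσ.1 α).1]
  | evar a => simp [Ty.inst, app, (hσ.2 a).1]
  | _ => simp_all [Ty.inst, app]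

theorem Plain.app_opn {σ : Sub} (hσ : σ.Plain) (A u : Ty) :
    σ.app (A.opn u) = (σ.app A).opn (σ.app u) :=
  hσ.app_inst A u 0

theorem Plain.nonPos {σ : Sub} (hσ : σ.Plain) {A : Ty} (h : A.NonPos) : (σ.app A).NonPos := by
  cases A with
  | uvar α => exact (hσ.1 α).2.1
  | evar a => exact (hσ.2 a).2.1
  | _ => exact h

theorem Plain.nonNeg {σ : Sub} (hσ : σ.Plain) {A : Ty} (h : A.NonNeg) : (σ.app A).NonNeg := by
  cases A with
  | uvar α => exact (hσ.1 α).2.2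
  | evar a => exact (hσ.2 a).2.2
  | _ => exact h

end Sub

/-- `Ty.cls α k A` replaces the free universal variable `α` by the bound variable with index `k`. -/
def Ty.cls (α : ℕ) : ℕ → Ty → Ty
  | _, bvar i => bvar i
  | k, uvar β => if β = α then bvar k else uvar β
  | _, evar a => evar a
  | _, unit => unit
  | k, bin op A B => bin op (cls α k A) (cls α k B)
  | _, zero => zero
  | k, succ t => succ (cls α k t)
  | k, all κ A => all κ (cls α (k + 1) A)
  | k, ex κ A => ex κ (cls α (k + 1) A)
  | k, imp s t A => imp (cls α k s) (cls α k t) (cls α k A)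
  | k, conj A s t => conj (cls α k A) (cls α k s) (cls α k t)
  | k, vec t A => vec (cls α k t) (cls α k A)

/-- As `α` does not occur in `A`, closing turns back exactly the occurrences created by opening.
Opening with a fresh variable is therefore injective. -/
theorem Ty.cls_inst {α : ℕ} {A : Ty} (h : α ∉ A.fuv) (k : ℕ) :
    Ty.cls α k (Ty.inst k (.uvar α) A) = A := by
  induction A generalizing k with
  | bvar i => by_cases hi : i = k <;> simp [Ty.inst, Ty.cls, hi]
  | uvar β =>
    have : β ≠ α := fun hβ => h (by simp [Ty.fuv, hβ])
    simp [Ty.inst, Ty.cls, this]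
  | _ => simp_all [Ty.inst, Ty.cls, Ty.fuv]

theorem Ty.opn_injective {α : ℕ} {A B : Ty} (hA : α ∉ A.fuv) (hB : α ∉ B.fuv)
    (h : A.opn (.uvar α) = B.opn (.uvar α)) : A = B := by
  rw [← Ty.cls_inst hA 0, ← Ty.cls_inst hB 0]
  exact congrArg _ h

/-! ## Declarations of algorithmic contexts -/

namespace Ctx

/-- `Γ` declares the existential variable `a`, unsolved or solved, with sort `κ`. -/
def HasE (Γ : Ctx) (a : ℕ) (κ : Srt) : Prop :=
  Entry.evar a κ ∈ Γ ∨ ∃ t, Entry.solved a κ t ∈ Γ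

theorem HasE.declaresE {Γ : Ctx} {a : ℕ} {κ : Srt} (h : Γ.HasE a κ) : Γ.DeclaresE a := by
  rcases h with h | ⟨t, h⟩
  · exact Or.inl ⟨κ, h⟩
  · exact Or.inr ⟨κ, t, h⟩

theorem DeclaresE.hasE {Γ : Ctx} {a : ℕ} (h : Γ.DeclaresE a) : ∃ κ, Γ.HasE a κ := by
  rcases h with ⟨κ, h⟩ | ⟨κ, t, h⟩
  · exact ⟨κ, Or.inl h⟩
  · exact ⟨κ, Or.inr ⟨t, h⟩⟩

/-- Every variable declared in `Γ` is declared in `Δ` with the same sort. -/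
def SubDecl (Γ Δ : Ctx) : Prop :=
  (∀ α κ, Entry.uvar α κ ∈ Γ → Entry.uvar α κ ∈ Δ) ∧ ∀ a κ, Γ.HasE a κ → Δ.HasE a κ

theorem SubDecl.of_subset {Γ Δ : Ctx} (h : ∀ e ∈ Γ, e ∈ Δ) : SubDecl Γ Δ :=
  ⟨fun _ _ => h _, fun _ _ ha => ha.imp (h _) fun ⟨t, ht⟩ => ⟨t, h _ ht⟩⟩

theorem SubDecl.cons (Γ : Ctx) (e : Entry) : SubDecl Γ (e :: Γ) :=
  .of_subset fun _ h => List.mem_cons_of_mem _ h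

theorem SubDecl.append {Γ Δ : Ctx} (h : SubDecl Γ Δ) (Γ₁ : Ctx) :
    SubDecl (Γ₁ ++ Γ) (Γ₁ ++ Δ) := by
  refine ⟨fun α κ hα => ?_, fun a κ ha => ?_⟩
  · rcases List.mem_append.1 hα with hα | hα
    · exact List.mem_append_left _ hα
    · exact List.mem_append_right _ (h.1 _ _ hα)
  · have key : Γ₁.HasE a κ ∨ Γ.HasE a κ := by
      simp only [HasE, List.mem_append] at ha ⊢
      grind
    rcases key with k | k
    · exact (SubDecl.of_subset fun e he => List.mem_append_left _ he).2 _ _ k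
    · exact (SubDecl.of_subset fun e he => List.mem_append_right _ he).2 _ _ (h.2 _ _ k)

theorem SubDecl.declaresE {Γ Δ : Ctx} (h : SubDecl Γ Δ) {a : ℕ} (ha : Γ.DeclaresE a) :
    Δ.DeclaresE a :=
  let ⟨_, hκ⟩ := ha.hasE
  (h.2 _ _ hκ).declaresE

theorem SubDecl.declaresU {Γ Δ : Ctx} (h : SubDecl Γ Δ) {α : ℕ} (hα : Γ.DeclaresU α) :
    Δ.DeclaresU α :=
  let ⟨κ, hκ⟩ := hα
  ⟨κ, h.1 _ _ hκ⟩

theorem declaresE_append {Γ Δ : Ctx} {a : ℕ} :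
    DeclaresE (Γ ++ Δ) a ↔ Γ.DeclaresE a ∨ Δ.DeclaresE a := by
  simp only [DeclaresE, List.mem_append]
  grind

theorem declaresE_evar_cons {Γ : Ctx} {a b : ℕ} {κ : Srt} :
    DeclaresE (.evar b κ :: Γ) a ↔ a = b ∨ Γ.DeclaresE a := by
  simp [DeclaresE, exists_or, or_assoc]

theorem declaresE_solved_cons {Γ : Ctx} {a b : ℕ} {κ : Srt} {t : Ty} :
    DeclaresE (.solved b κ t :: Γ) a ↔ a = b ∨ Γ.DeclaresE a := by
  simp [DeclaresE, exists_or, or_left_comm]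

theorem declaresU_append {Γ Δ : Ctx} {α : ℕ} :
    DeclaresU (Γ ++ Δ) α ↔ Γ.DeclaresU α ∨ Δ.DeclaresU α := by
  simp only [DeclaresU, List.mem_append]
  grind

end Ctx

/-! ### Weakening and instantiation for sorting and well-formed types. -/

theorem Sorting.mono {Γ Δ : Ctx} (h : Γ.SubDecl Δ) {bs : List Srt} {t : Ty} {κ : Srt}
    (ht : Sorting Γ bs t κ) : Sorting Δ bs t κ := by
  have he : ∀ {a κ}, Γ.HasE a κ → Sorting Δ bs (.evar a) κ := fun ha => by
    rcases h.2 _ _ ha with h' | ⟨t, h'⟩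
    · exact .evar h'
    · exact .solved h'
  induction ht with
  | bvar h' => exact .bvar h'
  | uvar h' => exact .uvar (h.1 _ _ h')
  | evar h' => exact he (.inl h')
  | solved h' => exact he (.inr ⟨_, h'⟩)
  | unit => exact .unit
  | bin _ _ ih₁ ih₂ => exact .bin ih₁ ih₂
  | zero => exact .zero
  | succ _ ih => exact .succ ih

theorem Sorting.typeWf {Γ : Ctx} {bs : List Srt} {t : Ty} {κ : Srt} (h : Sorting Γ bs t κ)
    (hκ : κ = .star) : TypeWf Γ bs t := by
  induction h with
  | bvar h => exact .bvar (hκ ▸ h)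
  | uvar h => exact .uvar (hκ ▸ h)
  | evar h => subst hκ; exact .evar h
  | solved h => subst hκ; exact .solved h
  | unit => exact .unit
  | bin _ _ ih₁ ih₂ => exact .bin (ih₁ rfl) (ih₂ rfl)
  | zero => cases hκ
  | succ => cases hκ

theorem TypeWf.mono {Γ Δ : Ctx} (h : Γ.SubDecl Δ) {bs : List Srt} {A : Ty}
    (hA : TypeWf Γ bs A) : TypeWf Δ bs A := by
  induction hA with
  | bvar h' => exact .bvar h'
  | uvar h' => exact .uvar (h.1 _ _ h')
  | evar h' => exact ((Sorting.evar h').mono h).typeWf rfl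
  | solved h' => exact ((Sorting.solved h').mono h).typeWf rfl
  | unit => exact .unit
  | bin _ _ ih₁ ih₂ => exact .bin ih₁ ih₂
  | all _ ih => exact .all ih
  | ex _ ih => exact .ex ih
  | imp hp _ ih => exact .imp ⟨hp.1.mono h, hp.2.mono h⟩ ih
  | conj _ hp ih => exact .conj ih ⟨hp.1.mono h, hp.2.mono h⟩
  | vec ht _ ih => exact .vec (ht.mono h) ih

theorem Sorting.weaken_bound {Γ : Ctx} {t : Ty} {κ : Srt} (h : Sorting Γ [] t κ)
    (bs : List Srt) : Sorting Γ bs t κ := by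
  induction h with
  | bvar h => simp at h
  | uvar h => exact .uvar h
  | evar h => exact .evar h
  | solved h => exact .solved h
  | unit => exact .unit
  | bin _ _ ih₁ ih₂ => exact .bin ih₁ ih₂
  | zero => exact .zero
  | succ _ ih => exact .succ ih

/-- The quantifier being removed is the outermost one, so its sort comes last in the list and its
index under the binders `bs` is `bs.length`. -/
theorem Sorting.inst {Γ : Ctx} {bs : List Srt} {κ κ' : Srt} {t u : Ty}
    (ht : Sorting Γ (bs ++ [κ]) t κ') (hu : Sorting Γ [] u κ) :
    Sorting Γ bs (Ty.inst bs.length u t) κ' := by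
  induction ht with
  | @bvar i κ' h =>
    by_cases hi : i = bs.length
    · subst hi
      simp only [List.getElem?_concat_length, Option.some.injEq] at h
      subst h
      simpa [Ty.inst] using hu.weaken_bound bs
    · have hlt : i < bs.length := by
        have := (List.getElem?_eq_some_iff.1 h).1
        simp at this
        omega
      rw [List.getElem?_append_left hlt] at h
      simpa [Ty.inst, hi] using Sorting.bvar h
  | uvar h => exact .uvar h
  | evar h => exact .evar h
  | solved h => exact .solved h
  | unit => exact .unit
  | bin _ _ ih₁ ih₂ => exact .bin ih₁ ih₂
  | zero => exact .zero
  | succ _ ih => exact .succ ih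

theorem TypeWf.inst {Γ : Ctx} {bs : List Srt} {κ : Srt} {A u : Ty}
    (hA : TypeWf Γ (bs ++ [κ]) A) (hu : Sorting Γ [] u κ) :
    TypeWf Γ bs (Ty.inst bs.length u A) := by
  generalize hbs : bs ++ [κ] = bs' at hA
  induction hA generalizing bs with
  | bvar h => subst hbs; exact ((Sorting.bvar h).inst hu).typeWf rfl
  | uvar h => exact .uvar h
  | evar h => exact .evar h
  | solved h => exact .solved h
  | unit => exact .unit
  | bin _ _ ih₁ ih₂ => exact .bin (ih₁ hbs) (ih₂ hbs)
  | all _ ih => exact .all (ih (bs := _ :: bs) (by simp [hbs]))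
  | ex _ ih => exact .ex (ih (bs := _ :: bs) (by simp [hbs]))
  | imp hp _ ih => subst hbs; exact .imp ⟨hp.1.inst hu, hp.2.inst hu⟩ (ih rfl)
  | conj _ hp ih => subst hbs; exact .conj (ih rfl) ⟨hp.1.inst hu, hp.2.inst hu⟩
  | vec ht _ ih => subst hbs; exact .vec (ht.inst hu) (ih rfl)

theorem TypeWf.opn {Γ : Ctx} {κ : Srt} {A u : Ty} (hA : TypeWf Γ [κ] A)
    (hu : Sorting Γ [] u κ) : TypeWf Γ [] (A.opn u) :=
  TypeWf.inst (bs := []) hA hu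

/-! ## Scoped contexts -/

/-- Contexts in which declarations and existential markers are not repeated and in which solutions
and equations are well-sorted over the prefix to their left.  Unlike `CtxWf`, this does not exclude
circular equations, and it is preserved by the algorithm. -/
inductive Scoped : Ctx → Prop
  | empty : Scoped []
  | hyp {Γ x A p} : Scoped Γ → Scoped (.hyp x A p :: Γ)
  | uvar {Γ α κ} : Scoped Γ → ¬ Γ.DeclaresU α → Scoped (.uvar α κ :: Γ)
  | evar {Γ a κ} : Scoped Γ → ¬ Γ.DeclaresE a → Scoped (.evar a κ :: Γ)
  | solved {Γ a κ t} : Scoped Γ → ¬ Γ.DeclaresE a → Sorting Γ [] t κ →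
      Scoped (.solved a κ t :: Γ)
  | eqn {Γ α κ t} : Scoped Γ → Entry.uvar α κ ∈ Γ → Sorting Γ [] t κ → Scoped (.eqn α t :: Γ)
  | marker {Γ m} : Scoped Γ → (∀ a, m = .evar a → Entry.marker m ∉ Γ) → Scoped (.marker m :: Γ)

theorem CtxWf.scoped {Γ : Ctx} (h : CtxWf Γ) : Scoped Γ := by
  induction h with
  | empty => exact .empty
  | hyp _ _ _ ih => exact .hyp ih
  | hypPrincipal _ _ _ _ ih => exact .hyp ih
  | uvar _ h ih => exact .uvar ih h
  | evar _ h ih => exact .evar ih h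
  | solved _ h ht ih => exact .solved ih h ht
  | eqn _ h _ ht _ ih => exact .eqn ih h ht
  | markerU _ _ ih => exact .marker ih fun _ h => nomatch h
  | markerE _ h ih => exact .marker ih fun _ _ => h
  | markerP _ ih => exact .marker ih fun _ h => nomatch h

theorem Scoped.tail {e : Entry} {Γ : Ctx} (h : Scoped (e :: Γ)) : Scoped Γ := by
  cases h <;> assumption

theorem Scoped.of_append {Γ₁ Γ : Ctx} (h : Scoped (Γ₁ ++ Γ)) : Scoped Γ := by
  induction Γ₁ with
  | nil => exact h
  | cons e Γ₁ ih => exact ih h.tail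

theorem Scoped.sorting_of_solved {Γ : Ctx} (h : Scoped Γ) {a : ℕ} {κ : Srt} {t : Ty}
    (ht : Entry.solved a κ t ∈ Γ) : Sorting Γ [] t κ := by
  induction h with
  | empty => simp at ht
  | solved _ _ hs ih =>
    rcases List.mem_cons.1 ht with h' | h'
    · cases h'; exact hs.mono (.cons _ _)
    · exact (ih h').mono (.cons _ _)
  | _ => rename_i ih; exact (ih (by simpa using ht)).mono (.cons _ _)

theorem Scoped.sorting_of_eqn {Γ : Ctx} (h : Scoped Γ) {α : ℕ} {t : Ty}
    (ht : Entry.eqn α t ∈ Γ) : ∃ κ, Entry.uvar α κ ∈ Γ ∧ Sorting Γ [] t κ := by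
  induction h with
  | empty => simp at ht
  | eqn _ hα hs ih =>
    rcases List.mem_cons.1 ht with h' | h'
    · cases h'; exact ⟨_, List.mem_cons_of_mem _ hα, hs.mono (.cons _ _)⟩
    · obtain ⟨κ, h₁, h₂⟩ := ih h'
      exact ⟨κ, List.mem_cons_of_mem _ h₁, h₂.mono (.cons _ _)⟩
  | _ =>
    rename_i ih
    obtain ⟨κ, h₁, h₂⟩ := ih (by simpa using ht)
    exact ⟨κ, List.mem_cons_of_mem _ h₁, h₂.mono (.cons _ _)⟩

/-- The entries of `Γ₁` use the prefix in two ways: they need its declarations, which `hsub` keeps,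
and they must not clash with it, which `hu`, `hm` and `he` ensure. -/
theorem Scoped.replace {Γ₁ Γ₀ Δ₀ : Ctx} (h : Scoped (Γ₁ ++ Γ₀)) (h₀ : Scoped Δ₀)
    (hsub : Γ₀.SubDecl Δ₀) (hu : ∀ α, Δ₀.DeclaresU α → Γ₀.DeclaresU α)
    (hm : ∀ m, Entry.marker m ∈ Δ₀ → Entry.marker m ∈ Γ₀)
    (he : ∀ a, Δ₀.DeclaresE a → Γ₀.DeclaresE a ∨ ¬ Ctx.DeclaresE Γ₁ a) :
    Scoped (Γ₁ ++ Δ₀) := by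
  induction Γ₁ with
  | nil => exact h₀
  | cons e Γ₁ ih =>
    have ih := ih h.tail fun a ha => (he a ha).imp id fun h' h'' =>
      h' ((Ctx.SubDecl.cons _ _).declaresE h'')
    have hsub' := hsub.append Γ₁
    have hE : ∀ a, ¬ Ctx.DeclaresE (Γ₁ ++ Γ₀) a → Ctx.DeclaresE (e :: Γ₁) a →
        ¬ Ctx.DeclaresE (Γ₁ ++ Δ₀) a := by
      intro a h₁ h₂ h₃
      rcases Ctx.declaresE_append.1 h₃ with h₃ | h₃
      · exact h₁ (Ctx.declaresE_append.2 (.inl h₃))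
      · rcases he a h₃ with h₃ | h₃
        · exact h₁ (Ctx.declaresE_append.2 (.inr h₃))
        · exact h₃ h₂
    rw [List.cons_append] at h ⊢
    cases h with
    | hyp h => exact .hyp ih
    | uvar h hα =>
      refine .uvar ih fun h' => hα ?_
      rw [Ctx.declaresU_append] at h' ⊢
      exact h'.imp id (hu _)
    | evar h ha => exact .evar ih (hE _ ha (.inl ⟨_, List.mem_cons_self⟩))
    | solved h ha ht =>
      exact .solved ih (hE _ ha (.inr ⟨_, _, List.mem_cons_self⟩)) (ht.mono hsub')
    | eqn h hα ht => exact .eqn ih (hsub'.1 _ _ hα) (ht.mono hsub')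
    | marker h hm' =>
      refine .marker ih fun a ha h' => hm' a ha ?_
      rw [List.mem_append] at h' ⊢
      exact h'.imp id (hm _)

/-! ## Extension of contexts by the algorithm -/

/-- Entries that declare an existential variable, unsolved or solved. -/
inductive Entry.IsE : Entry → Prop
  | evar (a κ) : IsE (.evar a κ)
  | solved (a κ t) : IsE (.solved a κ t)

/-- The shape of the extensions produced by the algorithm: existential variables are solved, and
new ones are added immediately to the left of those that are solved. -/
inductive SolveExt : Ctx → Ctx → Prop
  | nil : SolveExt [] []
  | keep {Γ Δ} (e : Entry) : SolveExt Γ Δ → SolveExt (e :: Γ) (e :: Δ)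
  | solve {Γ Δ N a κ t} : SolveExt Γ Δ → (∀ e ∈ N, Entry.IsE e) →
      SolveExt (.evar a κ :: Γ) (.solved a κ t :: (N ++ Δ))

namespace SolveExt

theorem refl (Γ : Ctx) : SolveExt Γ Γ := by
  induction Γ with
  | nil => exact .nil
  | cons e Γ ih => exact .keep e ih

theorem append {Γ Δ : Ctx} (h : SolveExt Γ Δ) (Γ₁ : Ctx) : SolveExt (Γ₁ ++ Γ) (Γ₁ ++ Δ) := by
  induction Γ₁ with
  | nil => exact h
  | cons e Γ₁ ih => exact .keep e ih

/-- Needed for transitivity: variables inserted by one step may be solved by the next, which inserts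
further ones among them. -/
theorem exists_of_append {N Γ Δ : Ctx} (hN : ∀ e ∈ N, Entry.IsE e) (h : SolveExt (N ++ Γ) Δ) :
    ∃ N' Δ', Δ = N' ++ Δ' ∧ (∀ e ∈ N', Entry.IsE e) ∧ SolveExt Γ Δ' := by
  induction N generalizing Δ with
  | nil => exact ⟨[], Δ, rfl, by simp, h⟩
  | cons e N ih =>
    have hN' : ∀ e ∈ N, Entry.IsE e := fun e he => hN e (List.mem_cons_of_mem _ he)
    cases h with
    | keep _ h =>
      obtain ⟨N', Δ', rfl, h₁, h₂⟩ := ih hN' h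
      refine ⟨e :: N', Δ', rfl, ?_, h₂⟩
      simpa using ⟨hN e List.mem_cons_self, h₁⟩
    | @solve _ _ M a κ t h hM =>
      obtain ⟨N', Δ', rfl, h₁, h₂⟩ := ih hN' h
      refine ⟨.solved a κ t :: (M ++ N'), Δ', by simp, fun e he => ?_, h₂⟩
      rcases List.mem_cons.1 he with rfl | he
      · exact .solved ..
      · exact (List.mem_append.1 he).elim (hM e) (h₁ e)

theorem trans {Γ Θ Δ : Ctx} (h₁ : SolveExt Γ Θ) (h₂ : SolveExt Θ Δ) : SolveExt Γ Δ := by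
  induction h₁ generalizing Δ with
  | nil => exact h₂
  | keep e _ ih =>
    cases h₂ with
    | keep _ h => exact .keep _ (ih h)
    | solve h hN => exact .solve (ih h) hN
  | solve _ hN ih =>
    cases h₂ with
    | keep _ h =>
      obtain ⟨N', Δ', rfl, h₁, h₂⟩ := exists_of_append hN h
      exact .solve (ih h₂) h₁

theorem mem {Γ Δ : Ctx} (h : SolveExt Γ Δ) {e : Entry} (he : e ∈ Γ) :
    e ∈ Δ ∨ ∃ a κ t, e = .evar a κ ∧ Entry.solved a κ t ∈ Δ := by
  induction h with
  | nil => simp at he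
  | keep e' _ ih => grind
  | solve _ _ ih => grind

theorem subDecl {Γ Δ : Ctx} (h : SolveExt Γ Δ) : Γ.SubDecl Δ := by
  refine ⟨fun α κ hα => ?_, fun a κ ha => ?_⟩
  · rcases h.mem hα with h | ⟨_, _, _, h, _⟩
    · exact h
    · cases h
  · rcases ha with ha | ⟨t, ha⟩
    · rcases h.mem ha with h | ⟨_, _, t, h, h'⟩
      · exact .inl h
      · cases h; exact .inr ⟨t, h'⟩
    · rcases h.mem ha with h | ⟨_, _, _, h, _⟩
      · exact .inr ⟨t, h⟩
      · cases h

/-- New entries only appear to the left of a solved variable, never at the right end. A nonempty `Θ`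
would thus end in a second declaration of `α`. -/
theorem uvar_split {Γ Δ Θ : Ctx} {α : ℕ} {κ : Srt}
    (h : SolveExt (.uvar α κ :: Γ) (Θ ++ .uvar α κ :: Δ))
    (hs : Scoped (Θ ++ .uvar α κ :: Δ)) : Θ = [] ∧ SolveExt Γ Δ := by
  cases Θ with
  | nil =>
    cases h with
    | keep _ h => exact ⟨rfl, h⟩
  | cons e Θ =>
    cases h
    cases hs with
    | uvar _ h => exact absurd ⟨κ, by simp⟩ h

/-- Only the variable to the right of the marker can change, and it is replaced by existential
entries. Since the marker is not repeated, these entries are all of `Θ`. -/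
theorem marker_split {Γ Δ Θ : Ctx} {a : ℕ} {κ : Srt}
    (h : SolveExt (.evar a κ :: .marker (.evar a) :: Γ) (Θ ++ .marker (.evar a) :: Δ))
    (hs : Scoped (Θ ++ .marker (.evar a) :: Δ)) :
    (∀ e ∈ Θ, Entry.IsE e) ∧ SolveExt Γ Δ ∧ Ctx.HasE Θ a κ := by
  -- A context has only one decomposition at the marker: `N` contains no marker, and a marker inside
  -- `Θ` would be a repetition.
  have aux : ∀ {N Θ Δ' : Ctx}, (∀ e ∈ N, Entry.IsE e) →
      N ++ .marker (.evar a) :: Δ' = Θ ++ .marker (.evar a) :: Δ →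
      Scoped (Θ ++ .marker (.evar a) :: Δ) → Θ = N ∧ Δ' = Δ := by
    intro N
    induction N with
    | nil =>
      intro Θ Δ' _ heq hs
      cases Θ with
      | nil => simpa using heq
      | cons e Θ =>
        simp only [List.nil_append, List.cons_append, List.cons.injEq] at heq
        obtain ⟨rfl, -⟩ := heq
        cases hs with
        | marker _ h => exact absurd (by simp) (h a rfl)
    | cons e N ih =>
      intro Θ Δ' hN heq hs
      cases Θ with
      | nil =>
        simp only [List.nil_append, List.cons_append, List.cons.injEq] at heq
        obtain ⟨rfl, -⟩ := heq
        exact nomatch hN _ List.mem_cons_self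
      | cons e' Θ =>
        simp only [List.cons_append, List.cons.injEq] at heq
        obtain ⟨rfl, heq⟩ := heq
        obtain ⟨rfl, rfl⟩ := ih (fun e he => hN e (List.mem_cons_of_mem _ he)) heq hs.tail
        exact ⟨rfl, rfl⟩
  generalize hX : Θ ++ .marker (.evar a) :: Δ = X at h
  cases h with
  | keep _ h =>
    cases h with
    | keep _ h =>
      obtain ⟨rfl, rfl⟩ := aux (N := [.evar a κ]) (by simpa using .evar a κ) hX.symm hs
      exact ⟨by simpa using .evar a κ, h, .inl (by simp)⟩
  | @solve _ _ N _ _ t h hN =>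
    cases h with
    | keep _ h =>
      have hN' : ∀ e ∈ Entry.solved a κ t :: N, Entry.IsE e := by
        simpa using ⟨.solved a κ t, hN⟩
      obtain ⟨rfl, rfl⟩ := aux hN' hX.symm hs
      exact ⟨hN', h, .inr ⟨t, by simp⟩⟩

end SolveExt

/-! ### The algorithmic judgments extend contexts and keep them scoped. -/

theorem Inst.solveExt {Γ Δ : Ctx} {a : ℕ} {t : Ty} {κ : Srt} (h : Inst Γ a t κ Δ) :
    SolveExt Γ Δ := by
  induction h with
  | @solve Γ₀ Γ₁ => exact .append (.solve (N := []) (.refl _) (by simp)) _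
  | reach => exact .append (.solve (N := []) (.refl _) (by simp)) _
  | bin _ _ _ _ _ _ _ ih₁ ih₂ =>
    refine .trans (.append (.solve (N := [_, _]) (.refl _) ?_) _) (ih₁.trans ih₂)
    simpa using ⟨.evar _ _, .evar _ _⟩
  | zero => exact .append (.solve (N := []) (.refl _) (by simp)) _
  | succ _ _ _ ih =>
    refine .trans (.append (.solve (N := [_]) (.refl _) ?_) _) ih
    simpa using .evar _ _

/-- The context change common to all instantiation rules; `N` holds the fresh components of the
solution and is empty unless the rule splits `a`. -/
theorem Scoped.solve_evar {Γ₁ Γ₀ N : Ctx} {a : ℕ} {κ : Srt} {t : Ty}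
    (h : Scoped (Γ₁ ++ .evar a κ :: Γ₀)) (hN : Scoped (N ++ Γ₀)) (hE : ∀ e ∈ N, Entry.IsE e)
    (hfresh : ∀ b, Ctx.DeclaresE N b → ¬ Ctx.DeclaresE (Γ₁ ++ .evar a κ :: Γ₀) b)
    (ht : Sorting (N ++ Γ₀) [] t κ) : Scoped (Γ₁ ++ .solved a κ t :: (N ++ Γ₀)) := by
  have ha : ¬ Ctx.DeclaresE Γ₀ a := by cases h.of_append; assumption
  refine h.replace (.solved hN (fun h' => ?_) ht) ⟨fun α κ' hα => ?_, fun b κ' hb => ?_⟩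
    (fun α hα => ?_) (fun m hm => ?_) fun b hb => ?_
  · rcases Ctx.declaresE_append.1 h' with h' | h'
    · exact hfresh _ h' (.inl ⟨κ, by simp⟩)
    · exact ha h'
  · simp at hα ⊢; exact .inr hα
  · rcases hb with hb | ⟨t', hb⟩
    · rcases List.mem_cons.1 hb with hb | hb
      · cases hb; exact .inr ⟨t, List.mem_cons_self⟩
      · exact .inl (by simp [hb])
    · exact .inr ⟨t', by simpa using .inr (.inr (by simpa using hb))⟩
  · obtain ⟨κ', hα⟩ := hα
    simp only [List.mem_cons, List.mem_append, reduceCtorEq, false_or] at hα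
    rcases hα with hα | hα
    · exact nomatch hE _ hα
    · exact ⟨κ', by simp [hα]⟩
  · simp only [List.mem_cons, List.mem_append, reduceCtorEq, false_or] at hm ⊢
    rcases hm with hm | hm
    · exact nomatch hE _ hm
    · exact hm
  · by_cases hbN : Ctx.DeclaresE N b
    · exact .inr fun h' => hfresh b hbN (Ctx.declaresE_append.2 (.inl h'))
    · left
      rw [Ctx.declaresE_solved_cons, Ctx.declaresE_append] at hb
      rw [Ctx.declaresE_evar_cons]
      exact hb.imp id fun hb => hb.resolve_left hbN

theorem Inst.scoped {Γ Δ : Ctx} {a : ℕ} {t : Ty} {κ : Srt} (h : Inst Γ a t κ Δ)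
    (hΓ : Scoped Γ) : Scoped Δ := by
  have hnil : ∀ b, ¬ Ctx.DeclaresE [] b := by simp [Ctx.DeclaresE]
  induction h with
  | solve ht =>
    exact hΓ.solve_evar (N := []) hΓ.of_append.tail (by simp) (fun b hb => absurd hb (hnil b)) ht
  | reach =>
    exact hΓ.solve_evar (N := []) hΓ.of_append.tail (by simp) (fun b hb => absurd hb (hnil b))
      (.evar (by simp))
  | @bin Γ₀ Γ₁ Θ Δ a a₁ a₂ op τ₁ τ₂ h₁ h₂ hne _ _ _ _ ih₁ ih₂ =>
    refine ih₂ (ih₁ (hΓ.solve_evar (N := [.evar a₁ .star, .evar a₂ .star]) ?_ ?_ ?_ ?_))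
    · have hsub : Ctx.SubDecl Γ₀ (Γ₁ ++ .evar a .star :: Γ₀) := .of_subset (by simp +contextual)
      refine .evar (.evar hΓ.of_append.tail fun h => h₂.1 (hsub.declaresE h)) fun h => ?_
      rcases Ctx.declaresE_evar_cons.1 h with h | h
      · exact hne h
      · exact h₁.1 (hsub.declaresE h)
    · simpa using ⟨.evar _ _, .evar _ _⟩
    · intro b hb
      have : b = a₁ ∨ b = a₂ := by simpa [Ctx.DeclaresE, exists_or] using hb
      rcases this with rfl | rfl
      · exact h₁.1
      · exact h₂.1
    · exact .bin (.evar (by simp)) (.evar (by simp))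
  | zero =>
    exact hΓ.solve_evar (N := []) hΓ.of_append.tail (by simp) (fun b hb => absurd hb (hnil b))
      .zero
  | @succ Γ₀ Γ₁ Δ a a₁ t h₁ _ _ ih =>
    refine ih (hΓ.solve_evar (N := [.evar a₁ .nat]) ?_ ?_ ?_ ?_)
    · have hsub : Ctx.SubDecl Γ₀ (Γ₁ ++ .evar a .nat :: Γ₀) := .of_subset (by simp +contextual)
      exact .evar hΓ.of_append.tail fun h => h₁.1 (hsub.declaresE h)
    · simpa using .evar _ _
    · intro b hb
      have : b = a₁ := by simpa [Ctx.DeclaresE] using hb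
      exact this ▸ h₁.1
    · exact .succ (.evar (by simp))

theorem CheckEq.solveExt {Γ Δ : Ctx} {s t : Ty} {κ : Srt} (h : CheckEq Γ s t κ Δ) :
    SolveExt Γ Δ := by
  induction h with
  | bin _ _ ih₁ ih₂ => exact ih₁.trans ih₂
  | succ _ ih => exact ih
  | instL h _ => exact h.solveExt
  | instR h _ => exact h.solveExt
  | _ => exact .refl _

theorem CheckEq.scoped {Γ Δ : Ctx} {s t : Ty} {κ : Srt} (h : CheckEq Γ s t κ Δ)
    (hΓ : Scoped Γ) : Scoped Δ := by
  induction h with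
  | bin _ _ ih₁ ih₂ => exact ih₂ (ih₁ hΓ)
  | succ _ ih => exact ih hΓ
  | instL h _ => exact h.scoped hΓ
  | instR h _ => exact h.scoped hΓ
  | _ => exact hΓ

theorem PropEquiv.solveExt {Γ Δ : Ctx} {s t s' t' : Ty} (h : PropEquiv Γ s t s' t' Δ) :
    SolveExt Γ Δ := by
  obtain ⟨h₁, h₂⟩ := h
  exact h₁.solveExt.trans h₂.solveExt

theorem PropEquiv.scoped {Γ Δ : Ctx} {s t s' t' : Ty} (h : PropEquiv Γ s t s' t' Δ)
    (hΓ : Scoped Γ) : Scoped Δ := by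
  obtain ⟨h₁, h₂⟩ := h
  exact h₂.scoped (h₁.scoped hΓ)

/-- Both facts are proved together, because `SolveExt.uvar_split` needs the premise's output to be
scoped before the extension can be cut at the bound variable. -/
theorem TypeEquiv.scoped_solveExt {Γ Δ : Ctx} {A B : Ty} (h : TypeEquiv Γ A B Δ)
    (hΓ : Scoped Γ) : Scoped Δ ∧ SolveExt Γ Δ := by
  induction h with
  | bin _ _ ih₁ ih₂ =>
    obtain ⟨h₁, h₁'⟩ := ih₁ hΓ
    exact ⟨(ih₂ h₁).1, h₁'.trans (ih₂ h₁).2⟩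
  | vec h _ ih =>
    have h' := ih (h.scoped hΓ)
    exact ⟨h'.1, h.solveExt.trans h'.2⟩
  | all hα _ _ _ ih =>
    obtain ⟨h₁, h₂⟩ := ih (.uvar hΓ hα.1)
    exact ⟨h₁.of_append.tail, (h₂.uvar_split h₁).2⟩
  | ex hα _ _ _ ih =>
    obtain ⟨h₁, h₂⟩ := ih (.uvar hΓ hα.1)
    exact ⟨h₁.of_append.tail, (h₂.uvar_split h₁).2⟩
  | imp h _ ih =>
    have h' := ih (h.scoped hΓ)
    exact ⟨h'.1, h.solveExt.trans h'.2⟩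
  | conj h _ ih =>
    have h' := ih (h.scoped hΓ)
    exact ⟨h'.1, h.solveExt.trans h'.2⟩
  | instL h _ => exact ⟨h.scoped hΓ, h.solveExt⟩
  | instR h _ => exact ⟨h.scoped hΓ, h.solveExt⟩
  | _ => exact ⟨hΓ, .refl _⟩

theorem Scoped.marker_evar {Γ : Ctx} (hΓ : Scoped Γ) {a : ℕ} (ha : Γ.FreshE a) (κ : Srt) :
    Scoped (.evar a κ :: .marker (.evar a) :: Γ) :=
  .evar (.marker hΓ fun _ _ => ha.2) fun h => ha.1 (by simpa [Ctx.DeclaresE] using h)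

theorem AlgSub.scoped_solveExt {pol : Polarity} {Γ Δ : Ctx} {A B : Ty} (h : AlgSub pol Γ A B Δ)
    (hΓ : Scoped Γ) : Scoped Δ ∧ SolveExt Γ Δ := by
  induction h with
  | equiv _ _ _ _ h => exact h.scoped_solveExt hΓ
  | allL _ ha _ _ _ ih =>
    obtain ⟨h₁, h₂⟩ := ih (hΓ.marker_evar ha _)
    exact ⟨h₁.of_append.tail, (h₂.marker_split h₁).2.1⟩
  | exR _ ha _ _ _ ih =>
    obtain ⟨h₁, h₂⟩ := ih (hΓ.marker_evar ha _)
    exact ⟨h₁.of_append.tail, (h₂.marker_split h₁).2.1⟩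
  | allR hα _ _ _ ih =>
    obtain ⟨h₁, h₂⟩ := ih (.uvar hΓ hα.1)
    exact ⟨h₁.of_append.tail, (h₂.uvar_split h₁).2⟩
  | exL hα _ _ _ ih =>
    obtain ⟨h₁, h₂⟩ := ih (.uvar hΓ hα.1)
    exact ⟨h₁.of_append.tail, (h₂.uvar_split h₁).2⟩
  | posNegL _ _ _ ih => exact ih hΓ
  | posNegR _ _ _ ih => exact ih hΓ
  | negPosL _ _ _ ih => exact ih hΓ
  | negPosR _ _ _ ih => exact ih hΓ

/-! ## Substitutions that satisfy a context -/

/-- `σ` satisfies the solutions and the equations of `Γ`. -/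
def Sub.Sat (σ : Sub) (Γ : Ctx) : Prop :=
  (∀ a κ t, Entry.solved a κ t ∈ Γ → σ.e a = σ.app t) ∧
    ∀ α t, Entry.eqn α t ∈ Γ → σ.u α = σ.app t

/-- `σ` and `σ'` agree on the variables declared in `Γ`. -/
def Sub.AgreeOn (σ σ' : Sub) (Γ : Ctx) : Prop :=
  (∀ α, Γ.DeclaresU α → σ.u α = σ'.u α) ∧ ∀ a, Γ.DeclaresE a → σ.e a = σ'.e a

/-- Solutions and equations of `Γ` survive verbatim in `Δ`, so `Δ` only imposes more constraints. -/
theorem Sub.Sat.mono {σ : Sub} {Γ Δ : Ctx} (hσ : σ.Sat Δ) (h : SolveExt Γ Δ) : σ.Sat Γ := by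
  refine ⟨fun a κ t ht => ?_, fun α t ht => ?_⟩
  · rcases h.mem ht with h | ⟨_, _, _, h, _⟩
    · exact hσ.1 _ _ _ h
    · cases h
  · rcases h.mem ht with h | ⟨_, _, _, h, _⟩
    · exact hσ.2 _ _ h
    · cases h

/-- Each entry of `Γ` replaces a variable by a term of equal `σ`-value. Neither the order of the
entries nor acyclicity matters. -/
theorem Sub.Sat.app_apply {σ : Sub} {Γ : Ctx} (hσ : σ.Sat Γ) (A : Ty) :
    σ.app (Γ.apply A) = σ.app A := by
  induction Γ generalizing A with
  | nil => rfl
  | cons e Γ ih =>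
    have ih := ih ⟨fun a κ t h => hσ.1 a κ t (List.mem_cons_of_mem _ h),
      fun α t h => hσ.2 α t (List.mem_cons_of_mem _ h)⟩
    cases e with
    | solved a κ t =>
      rw [Ctx.apply, app_substE, ih]
      rw [ih]; exact hσ.1 a κ t List.mem_cons_self
    | eqn α t =>
      rw [Ctx.apply, app_substU, ih]
      rw [ih]; exact hσ.2 α t List.mem_cons_self
    | _ => exact ih A

theorem Sub.AgreeOn.app_sorting {σ σ' : Sub} {Γ : Ctx} (h : σ.AgreeOn σ' Γ) {bs : List Srt}
    {t : Ty} {κ : Srt} (ht : Sorting Γ bs t κ) : σ.app t = σ'.app t := by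
  induction ht with
  | uvar h' => exact h.1 _ ⟨_, h'⟩
  | evar h' => exact h.2 _ (.inl ⟨_, h'⟩)
  | solved h' => exact h.2 _ (.inr ⟨_, _, h'⟩)
  | _ => simp_all [Sub.app]

theorem Sub.AgreeOn.app_typeWf {σ σ' : Sub} {Γ : Ctx} (h : σ.AgreeOn σ' Γ) {bs : List Srt}
    {A : Ty} (hA : TypeWf Γ bs A) : σ.app A = σ'.app A := by
  induction hA with
  | uvar h' => exact h.1 _ ⟨_, h'⟩
  | evar h' => exact h.2 _ (.inl ⟨_, h'⟩)
  | solved h' => exact h.2 _ (.inr ⟨_, _, h'⟩)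
  | imp hp _ ih => simp [Sub.app, ih, h.app_sorting hp.1, h.app_sorting hp.2]
  | conj _ hp ih => simp [Sub.app, ih, h.app_sorting hp.1, h.app_sorting hp.2]
  | vec ht _ ih => simp [Sub.app, ih, h.app_sorting ht]
  | _ => simp_all [Sub.app]

/-- In a scoped context, solutions and equations mention declared variables only. -/
theorem Sub.Sat.congr {σ σ' : Sub} {Γ : Ctx} (hσ : σ.Sat Γ) (hΓ : Scoped Γ)
    (h : σ.AgreeOn σ' Γ) : σ'.Sat Γ := by
  refine ⟨fun a κ t ht => ?_, fun α t ht => ?_⟩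
  · rw [← h.2 a (.inr ⟨_, _, ht⟩), ← h.app_sorting (hΓ.sorting_of_solved ht), hσ.1 a κ t ht]
  · obtain ⟨κ, hα, hs⟩ := hΓ.sorting_of_eqn ht
    rw [← h.1 α ⟨_, hα⟩, ← h.app_sorting hs, hσ.2 α t ht]

theorem Sub.agreeOn_updU {σ : Sub} {Γ : Ctx} {α : ℕ} (h : ¬ Γ.DeclaresU α) (t : Ty) :
    σ.AgreeOn (σ.updU α t) Γ := by
  refine ⟨fun β hβ => ?_, fun _ _ => rfl⟩
  have : β ≠ α := fun h' => h (h' ▸ hβ)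
  simp [Sub.updU, this]

theorem Sub.agreeOn_updE {σ : Sub} {Γ : Ctx} {a : ℕ} (h : ¬ Γ.DeclaresE a) (t : Ty) :
    σ.AgreeOn (σ.updE a t) Γ := by
  refine ⟨fun _ _ => rfl, fun b hb => ?_⟩
  have : b ≠ a := fun h' => h (h' ▸ hb)
  simp [Sub.updE, this]

/-! ## Soundness of instantiation and equivalence -/

/-- The solution recorded for `a` stays in the output. When it is split into fresh components, the
recursive calls identify these with the components of `t`. -/
theorem Inst.sound {Γ Δ : Ctx} {a : ℕ} {t : Ty} {κ : Srt} (h : Inst Γ a t κ Δ) {σ : Sub}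
    (hσ : σ.Sat Δ) : σ.e a = σ.app t := by
  induction h with
  | solve => exact hσ.1 _ _ _ (List.mem_append_right _ List.mem_cons_self)
  | reach => exact (hσ.1 _ _ _ (List.mem_append_right _ List.mem_cons_self)).symm
  | bin _ _ _ _ _ h₁ h₂ ih₁ ih₂ =>
    have hΘ := hσ.mono h₂.solveExt
    have := (hΘ.mono h₁.solveExt).1 _ _ _ (List.mem_append_right _ List.mem_cons_self)
    rw [this]
    simp only [Sub.app]
    rw [ih₁ hΘ, ih₂ hσ, hΘ.app_apply]
  | zero => exact hσ.1 _ _ _ (List.mem_append_right _ List.mem_cons_self)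
  | succ _ _ h ih =>
    rw [(hσ.mono h.solveExt).1 _ _ _ (List.mem_append_right _ List.mem_cons_self)]
    simp only [Sub.app]
    rw [ih hσ]

theorem CheckEq.sound {Γ Δ : Ctx} {s t : Ty} {κ : Srt} (h : CheckEq Γ s t κ Δ) {σ : Sub}
    (hσ : σ.Sat Δ) : σ.app s = σ.app t := by
  induction h with
  | bin _ h₂ ih₁ ih₂ =>
    have hΘ := hσ.mono h₂.solveExt
    have ih₂ := ih₂ hσ
    rw [hΘ.app_apply, hΘ.app_apply] at ih₂
    simp only [Sub.app]
    rw [ih₁ hΘ, ih₂]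
  | succ _ ih => simp only [Sub.app]; rw [ih hσ]
  | instL h _ => exact h.sound hσ
  | instR h _ => exact (h.sound hσ).symm
  | _ => rfl

theorem PropEquiv.sound {Γ Δ : Ctx} {s t s' t' : Ty} (h : PropEquiv Γ s t s' t' Δ) {σ : Sub}
    (hσ : σ.Sat Δ) : σ.app s = σ.app s' ∧ σ.app t = σ.app t' := by
  obtain ⟨h₁, h₂⟩ := h
  have hΘ := hσ.mono h₂.solveExt
  have h := h₂.sound hσ
  rw [hΘ.app_apply, hΘ.app_apply] at h
  exact ⟨h₁.sound hΘ, h⟩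

/-- A quantifier rule of type equivalence is sound if its premise is: interpret the new universal
variable by a variable that is fresh for both sides. -/
theorem app_eq_of_fresh {Δ : Ctx} {A B : Ty} {α : ℕ} {κ : Srt} (hΔ : Scoped (.uvar α κ :: Δ))
    (hA : α ∉ A.fuv) (hB : α ∉ B.fuv)
    (h : ∀ σ : Sub, σ.Plain → σ.Sat (.uvar α κ :: Δ) →
      σ.app (A.opn (.uvar α)) = σ.app (B.opn (.uvar α)))
    {σ : Sub} (hσ : σ.Plain) (hsat : σ.Sat Δ) : σ.app A = σ.app B := by
  obtain ⟨β, hβ⟩ := Infinite.exists_notMem_finset ((σ.app A).fuv ∪ (σ.app B).fuv)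
  rw [Finset.mem_union, not_or] at hβ
  have hα : ¬ Δ.DeclaresU α := by cases hΔ; assumption
  have hsat' : (σ.updU α (.uvar β)).Sat (.uvar α κ :: Δ) := by
    have := hsat.congr hΔ.tail (Sub.agreeOn_updU hα (.uvar β))
    exact ⟨fun a κ t ht => this.1 a κ t (by simpa using ht),
      fun α t ht => this.2 α t (by simpa using ht)⟩
  have hp := hσ.updU (α := α) (Ty.Plain.uvar β)
  have := h _ hp hsat'
  rw [hp.app_opn, hp.app_opn, Sub.app_updU hA, Sub.app_updU hB] at this
  have hα' : (σ.updU α (.uvar β)).app (.uvar α) = .uvar β := by simp [Sub.app, Sub.updU]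
  rw [hα'] at this
  exact Ty.opn_injective hβ.1 hβ.2 this

/-- The algorithm is a unification procedure, and every plain substitution satisfying its output is
a unifier. Sorts play no role; plainness serves only to pass under quantifiers. -/
theorem TypeEquiv.sound {Γ Δ : Ctx} {A B : Ty} (h : TypeEquiv Γ A B Δ) (hΓ : Scoped Γ) {σ : Sub}
    (hσ : σ.Plain) (hsat : σ.Sat Δ) : σ.app A = σ.app B := by
  induction h generalizing σ with
  | bin h₁ h₂ ih₁ ih₂ =>
    have hs := (h₁.scoped_solveExt hΓ).1
    have hΘ := hsat.mono (h₂.scoped_solveExt hs).2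
    have ih₂ := ih₂ hs hσ hsat
    rw [hΘ.app_apply, hΘ.app_apply] at ih₂
    simp only [Sub.app]
    rw [ih₁ hΓ hσ hΘ, ih₂]
  | vec h₁ h₂ ih =>
    have hs := h₁.scoped hΓ
    have hΘ := hsat.mono (h₂.scoped_solveExt hs).2
    have ih := ih hs hσ hsat
    rw [hΘ.app_apply, hΘ.app_apply] at ih
    simp only [Sub.app]
    rw [h₁.sound hΘ, ih]
  | @all Γ _ _ κ _ _ α hα hA hB h ih =>
    have hs : Scoped (.uvar α κ :: Γ) := .uvar hΓ hα.1
    obtain ⟨h₁, h₂⟩ := h.scoped_solveExt hs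
    obtain ⟨rfl, -⟩ := h₂.uvar_split h₁
    simp only [Sub.app]
    rw [app_eq_of_fresh h₁ hA hB (fun σ hσ hsat => ih hs hσ hsat) hσ hsat]
  | @ex Γ _ _ κ _ _ α hα hA hB h ih =>
    have hs : Scoped (.uvar α κ :: Γ) := .uvar hΓ hα.1
    obtain ⟨h₁, h₂⟩ := h.scoped_solveExt hs
    obtain ⟨rfl, -⟩ := h₂.uvar_split h₁
    simp only [Sub.app]
    rw [app_eq_of_fresh h₁ hA hB (fun σ hσ hsat => ih hs hσ hsat) hσ hsat]
  | imp h₁ h₂ ih =>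
    have hs := h₁.scoped hΓ
    have hΘ := hsat.mono (h₂.scoped_solveExt hs).2
    have ih := ih hs hσ hsat
    rw [hΘ.app_apply, hΘ.app_apply] at ih
    simp only [Sub.app]
    rw [(h₁.sound hΘ).1, (h₁.sound hΘ).2, ih]
  | conj h₁ h₂ ih =>
    have hs := h₁.scoped hΓ
    have hΘ := hsat.mono (h₂.scoped_solveExt hs).2
    have ih := ih hs hσ hsat
    rw [hΘ.app_apply, hΘ.app_apply] at ih
    simp only [Sub.app]
    rw [(h₁.sound hΘ).1, (h₁.sound hΘ).2, ih]
  | instL h _ => exact h.sound hsat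
  | instR h _ => exact (h.sound hsat).symm
  | _ => rfl

/-! ## Interpretations in declarative contexts -/

theorem DSorting.mono {Ψ Φ : DCtx} (h : ∀ α κ, DEntry.uvar α κ ∈ Ψ → DEntry.uvar α κ ∈ Φ)
    {bs : List Srt} {t : Ty} {κ : Srt} (ht : DSorting Ψ bs t κ) : DSorting Φ bs t κ := by
  induction ht with
  | bvar h' => exact .bvar h'
  | uvar h' => exact .uvar (h _ _ h')
  | unit => exact .unit
  | bin _ _ ih₁ ih₂ => exact .bin ih₁ ih₂
  | zero => exact .zero
  | succ _ ih => exact .succ ih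

theorem DSorting.weaken_bound {Ψ : DCtx} {t : Ty} {κ : Srt} (h : DSorting Ψ [] t κ)
    (bs : List Srt) : DSorting Ψ bs t κ := by
  induction h with
  | bvar h => simp at h
  | uvar h => exact .uvar h
  | unit => exact .unit
  | bin _ _ ih₁ ih₂ => exact .bin ih₁ ih₂
  | zero => exact .zero
  | succ _ ih => exact .succ ih

theorem DSorting.typeWf {Ψ : DCtx} {bs : List Srt} {t : Ty} {κ : Srt} (h : DSorting Ψ bs t κ)
    (hκ : κ = .star) : DTypeWf Ψ bs t := by
  induction h with
  | bvar h => exact .bvar (hκ ▸ h)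
  | uvar h => exact .uvar (hκ ▸ h)
  | unit => exact .unit
  | bin _ _ ih₁ ih₂ => exact .bin (ih₁ rfl) (ih₂ rfl)
  | zero => cases hκ
  | succ => cases hκ

theorem DSorting.fev {Ψ : DCtx} {bs : List Srt} {t : Ty} {κ : Srt} (h : DSorting Ψ bs t κ) :
    t.fev = ∅ := by
  induction h <;> simp_all [Ty.fev]

theorem DSorting.plain {Ψ : DCtx} {t : Ty} {κ : Srt} (h : DSorting Ψ [] t κ) : t.Plain := by
  refine ⟨fun k u => ?_, ?_, ?_⟩
  · induction h with
    | bvar h => simp at h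
    | _ => simp_all [Ty.inst]
  · cases h <;> exact fun h => h
  · cases h <;> exact fun h => h

/-- `σ` maps the variables declared in `Γ` to terms of the same sort over `Ψ`. -/
def Interp (Ψ : DCtx) (σ : Sub) (Γ : Ctx) : Prop :=
  (∀ α κ, Entry.uvar α κ ∈ Γ → DSorting Ψ [] (σ.u α) κ) ∧
    ∀ a κ, Γ.HasE a κ → DSorting Ψ [] (σ.e a) κ

theorem Interp.mono {Ψ : DCtx} {σ : Sub} {Γ Δ : Ctx} (h : Interp Ψ σ Δ) (hsub : Γ.SubDecl Δ) :
    Interp Ψ σ Γ :=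
  ⟨fun α κ hα => h.1 α κ (hsub.1 _ _ hα), fun a κ ha => h.2 a κ (hsub.2 _ _ ha)⟩

theorem Interp.congr {Ψ Φ : DCtx} {σ σ' : Sub} {Γ : Ctx} (h : Interp Ψ σ Γ)
    (hσ : σ.AgreeOn σ' Γ) (hΨ : ∀ α κ, DEntry.uvar α κ ∈ Ψ → DEntry.uvar α κ ∈ Φ) :
    Interp Φ σ' Γ :=
  ⟨fun α κ hα => hσ.1 α ⟨κ, hα⟩ ▸ (h.1 α κ hα).mono hΨ,
    fun a κ ha => hσ.2 a ha.declaresE ▸ (h.2 a κ ha).mono hΨ⟩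

theorem Interp.dSorting {Ψ : DCtx} {σ : Sub} {Γ : Ctx} (h : Interp Ψ σ Γ) {bs : List Srt}
    {t : Ty} {κ : Srt} (ht : Sorting Γ bs t κ) : DSorting Ψ bs (σ.app t) κ := by
  induction ht with
  | bvar h' => exact .bvar h'
  | uvar h' => exact (h.1 _ _ h').weaken_bound bs
  | evar h' => exact (h.2 _ _ (.inl h')).weaken_bound bs
  | solved h' => exact (h.2 _ _ (.inr ⟨_, h'⟩)).weaken_bound bs
  | unit => exact .unit
  | bin _ _ ih₁ ih₂ => exact .bin ih₁ ih₂
  | zero => exact .zero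
  | succ _ ih => exact .succ ih

theorem Interp.dTypeWf {Ψ : DCtx} {σ : Sub} {Γ : Ctx} (h : Interp Ψ σ Γ) {bs : List Srt}
    {A : Ty} (hA : TypeWf Γ bs A) : DTypeWf Ψ bs (σ.app A) := by
  induction hA with
  | bvar h' => exact .bvar h'
  | uvar h' => exact (h.dSorting (.uvar h')).typeWf rfl
  | evar h' => exact (h.dSorting (.evar h')).typeWf rfl
  | solved h' => exact (h.dSorting (.solved h')).typeWf rfl
  | unit => exact .unit
  | bin _ _ ih₁ ih₂ => exact .bin ih₁ ih₂
  | all _ ih => exact .all ih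
  | ex _ ih => exact .ex ih
  | imp hp _ ih => exact .imp ⟨h.dSorting hp.1, h.dSorting hp.2⟩ ih
  | conj _ hp ih => exact .conj ih ⟨h.dSorting hp.1, h.dSorting hp.2⟩
  | vec ht _ ih => exact .vec (h.dSorting ht) ih

/-- `σ` is a plain, well-sorted substitution that satisfies `Γ`. -/
structure Models (Ψ : DCtx) (σ : Sub) (Γ : Ctx) : Prop where
  plain : σ.Plain
  interp : Interp Ψ σ Γ
  sat : σ.Sat Γ

/-- Supplies default values for existential variables that the algorithm leaves unsolved. -/
theorem exists_dSorting (Ψ : DCtx) (κ : Srt) : ∃ t, DSorting Ψ [] t κ := by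
  cases κ with
  | star => exact ⟨_, .unit⟩
  | nat => exact ⟨_, .zero⟩

/-- Values are chosen from left to right: the solution forces the value of a solved variable, and
any term of the right sort serves for an unsolved one. Scoping keeps later choices from disturbing
earlier constraints. -/
theorem Models.extend {Ψ : DCtx} {σ : Sub} {Δ N : Ctx} (h : Models Ψ σ Δ)
    (hN : ∀ e ∈ N, Entry.IsE e) (hs : Scoped (N ++ Δ)) :
    ∃ σ' : Sub, Models Ψ σ' (N ++ Δ) ∧ σ.AgreeOn σ' Δ := by
  induction N with
  | nil => exact ⟨σ, h, fun _ _ => rfl, fun _ _ => rfl⟩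
  | cons e N ih =>
    obtain ⟨σ', hσ', hag⟩ := ih (fun e he => hN e (List.mem_cons_of_mem _ he)) hs.tail
    have key : ∀ {a t}, ¬ Ctx.DeclaresE (N ++ Δ) a → σ.AgreeOn (σ'.updE a t) Δ := by
      intro a t ha
      refine ⟨fun α hα => hag.1 α hα, fun b hb => (hag.2 b hb).trans ?_⟩
      exact (Sub.agreeOn_updE ha t).2 b (Ctx.declaresE_append.2 (.inr hb))
    rw [List.cons_append] at hs ⊢
    cases hN e List.mem_cons_self with
    | evar a κ =>
      obtain ⟨hs, ha⟩ : Scoped (N ++ Δ) ∧ ¬ Ctx.DeclaresE (N ++ Δ) a := by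
        cases hs; exact ⟨‹_›, ‹_›⟩
      obtain ⟨t, ht⟩ := exists_dSorting Ψ κ
      have hagr := Sub.agreeOn_updE (σ := σ') ha t
      refine ⟨σ'.updE a t, ⟨hσ'.plain.updE ht.plain, ⟨?_, ?_⟩, ?_⟩, key ha⟩
      · intro α κ' hα
        exact hσ'.interp.1 α κ' (by simpa using hα)
      · intro b κ' hb
        by_cases hba : Ctx.HasE (N ++ Δ) b κ'
        · exact (hσ'.interp.congr hagr fun _ _ h => h).2 b κ' hba
        · have : b = a ∧ κ' = κ := by
            simp only [Ctx.HasE, List.mem_cons, Entry.evar.injEq, reduceCtorEq, false_or] at hb hba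
            grind
          obtain ⟨rfl, rfl⟩ := this
          simpa [Sub.updE] using ht
      · have := hσ'.sat.congr hs hagr
        exact ⟨fun b κ' t' h' => this.1 b κ' t' (by simpa using h'),
          fun α t' h' => this.2 α t' (by simpa using h')⟩
    | solved a κ t =>
      obtain ⟨hs, ha, hst⟩ : Scoped (N ++ Δ) ∧ ¬ Ctx.DeclaresE (N ++ Δ) a ∧
          Sorting (N ++ Δ) [] t κ := by
        cases hs; exact ⟨‹_›, ‹_›, ‹_›⟩
      have ht := hσ'.interp.dSorting hst
      have hagr := Sub.agreeOn_updE (σ := σ') ha (σ'.app t)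
      refine ⟨σ'.updE a (σ'.app t), ⟨hσ'.plain.updE ht.plain, ⟨?_, ?_⟩, ?_⟩, key ha⟩
      · intro α κ' hα
        exact hσ'.interp.1 α κ' (by simpa using hα)
      · intro b κ' hb
        by_cases hba : Ctx.HasE (N ++ Δ) b κ'
        · exact (hσ'.interp.congr hagr fun _ _ h => h).2 b κ' hba
        · have : b = a ∧ κ' = κ := by
            simp only [Ctx.HasE, List.mem_cons, Entry.solved.injEq, reduceCtorEq, false_or]
              at hb hba
            grind
          obtain ⟨rfl, rfl⟩ := this
          simpa [Sub.updE] using ht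
      · have := hσ'.sat.congr hs hagr
        refine ⟨fun b κ' t' h' => ?_, fun α t' h' => this.2 α t' (by simpa using h')⟩
        rcases List.mem_cons.1 h' with h' | h'
        · cases h'
          -- The solution `t` is sorted over the prefix, which does not declare `a`, so updating `a`
          -- leaves the value of `t` unchanged.
          rw [← hagr.app_sorting hst]
          simp [Sub.updE]
        · exact this.1 b κ' t' h'

/-! ## Soundness of algorithmic subtyping -/

theorem DCtx.exists_fresh (Ψ : DCtx) (S : Finset ℕ) : ∃ β, ¬ Ψ.Declares β ∧ β ∉ S := by
  have : ∃ T : Finset ℕ, ∀ β, Ψ.Declares β → β ∈ T := by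
    induction Ψ with
    | nil => exact ⟨∅, by simp [DCtx.Declares]⟩
    | cons e Ψ ih =>
      obtain ⟨T, hT⟩ := ih
      cases e with
      | hyp x A p => exact ⟨T, fun β hβ => hT β (by simpa [DCtx.Declares] using hβ)⟩
      | uvar α κ =>
        refine ⟨insert α T, fun β ⟨κ', hβ⟩ => ?_⟩
        rcases List.mem_cons.1 hβ with h | h
        · cases h; simp
        · exact Finset.mem_insert_of_mem (hT β ⟨κ', h⟩)
  obtain ⟨T, hT⟩ := this
  obtain ⟨β, hβ⟩ := Infinite.exists_notMem_finset (T ∪ S)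
  rw [Finset.mem_union, not_or] at hβ
  exact ⟨β, fun h => hβ.1 (hT β h), hβ.2⟩

/-- Old values only need weakening, and the constraints of `Δ` do not mention `α`, so `β` may be
arbitrary here. -/
theorem Models.uvar {Ψ : DCtx} {σ : Sub} {Δ : Ctx} (h : Models Ψ σ Δ) {α : ℕ} {κ : Srt}
    (hs : Scoped (.uvar α κ :: Δ)) (β : ℕ) :
    Models (.uvar β κ :: Ψ) (σ.updU α (.uvar β)) (.uvar α κ :: Δ) := by
  obtain ⟨hs, hα⟩ : Scoped Δ ∧ ¬ Δ.DeclaresU α := by cases hs; exact ⟨‹_›, ‹_›⟩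
  have hagr := Sub.agreeOn_updU (σ := σ) hα (.uvar β)
  have hi := h.interp.congr hagr (Φ := .uvar β κ :: Ψ) fun _ _ h => List.mem_cons_of_mem _ h
  have hsat := h.sat.congr hs hagr
  refine ⟨h.plain.updU (.uvar β), ⟨fun γ κ' hγ => ?_, fun a κ' ha => ?_⟩,
    fun a κ t ht => hsat.1 a κ t (by simpa using ht), fun α t ht => hsat.2 α t (by simpa using ht)⟩
  · rcases List.mem_cons.1 hγ with h' | h'
    · cases h'
      simpa [Sub.updU] using DSorting.uvar List.mem_cons_self
    · exact hi.1 γ κ' h'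
  · exact hi.2 a κ' (by simpa [Ctx.HasE] using ha)

theorem Ty.IsNeg.nonPos {A : Ty} (h : A.IsNeg) : A.NonPos := by
  cases A <;> first | exact fun h => h | exact h.elim

theorem Ty.IsPos.nonNeg {A : Ty} (h : A.IsPos) : A.NonNeg := by
  cases A <;> first | exact fun h => h | exact h.elim

/-- The premise of a rule that introduces a universal variable `α`, interpreted by a fresh
variable. -/
theorem exists_fresh_interpretation {Ψ : DCtx} {σ : Sub} {Γ Δ Θ : Ctx} {A B : Ty} {α : ℕ} {κ : Srt}
    (hext : SolveExt (.uvar α κ :: Γ) (Θ ++ .uvar α κ :: Δ))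
    (hs : Scoped (Θ ++ .uvar α κ :: Δ)) (hA : α ∉ A.fuv) (hB : α ∉ B.fuv)
    (hσ : Models Ψ σ Δ) :
    ∃ (β : ℕ) (σ' : Sub), ¬ Ψ.Declares β ∧ β ∉ (σ.app A).fuv ∧ β ∉ (σ.app B).fuv ∧
      Models (.uvar β κ :: Ψ) σ' (Θ ++ .uvar α κ :: Δ) ∧ σ'.app A = σ.app A ∧
      σ'.app B = σ.app B ∧ σ'.app (.uvar α) = .uvar β := by
  obtain ⟨rfl, -⟩ := hext.uvar_split hs
  obtain ⟨β, hβ, hβ'⟩ := Ψ.exists_fresh ((σ.app A).fuv ∪ (σ.app B).fuv)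
  rw [Finset.mem_union, not_or] at hβ'
  exact ⟨β, σ.updU α (.uvar β), hβ, hβ'.1, hβ'.2, hσ.uvar hs β, Sub.app_updU hA, Sub.app_updU hB,
    by simp [Sub.app, Sub.updU]⟩

/-- The premise of a rule that introduces an existential variable `a`, interpreted by its
solution. -/
theorem exists_solution {Ψ : DCtx} {σ : Sub} {Γ Δ Θ : Ctx} {a : ℕ} {κ : Srt}
    (hext : SolveExt (.evar a κ :: .marker (.evar a) :: Γ) (Θ ++ .marker (.evar a) :: Δ))
    (hs : Scoped (Θ ++ .marker (.evar a) :: Δ)) (hσ : Models Ψ σ Δ) :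
    ∃ σ' : Sub, Models Ψ σ' (Θ ++ .marker (.evar a) :: Δ) ∧ σ'.AgreeOn σ Γ ∧
      DSorting Ψ [] (σ'.app (.evar a)) κ := by
  obtain ⟨hΘ, hΓΔ, ha⟩ := hext.marker_split hs
  have hσm : Models Ψ σ (.marker (.evar a) :: Δ) :=
    ⟨hσ.plain, ⟨fun α κ h => hσ.interp.1 α κ (by simpa using h),
      fun a κ h => hσ.interp.2 a κ (by simpa [Ctx.HasE] using h)⟩,
      fun a κ t h => hσ.sat.1 a κ t (by simpa using h),
      fun α t h => hσ.sat.2 α t (by simpa using h)⟩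
  obtain ⟨σ', hσ', hagr⟩ := hσm.extend hΘ hs
  have hsub : Δ.SubDecl (.marker (.evar a) :: Δ) := .cons _ _
  refine ⟨σ', hσ',
    ⟨fun α hα => (hagr.1 α (hsub.declaresU (hΓΔ.subDecl.declaresU hα))).symm,
      fun b hb => (hagr.2 b (hsub.declaresE (hΓΔ.subDecl.declaresE hb))).symm⟩,
    hσ'.interp.2 a κ ?_⟩
  exact (Ctx.SubDecl.of_subset fun e he => List.mem_append_left _ he).2 _ _ ha

/-- Induction on the derivation with `Ψ` and `σ` universally quantified, since each quantifier rule
applies the hypothesis to a different model. -/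
theorem AlgSub.sound {pol : Polarity} {Γ Δ : Ctx} {A B : Ty} (h : AlgSub pol Γ A B Δ)
    (hΓ : Scoped Γ) (hA : TypeWf Γ [] A) (hB : TypeWf Γ [] B) {Ψ : DCtx} {σ : Sub}
    (hσ : Models Ψ σ Δ) : DSub pol Ψ (σ.app A) (σ.app B) := by
  induction h generalizing Ψ σ with
  | equiv h₁ h₂ _ _ h =>
    -- Equivalent types have the same interpretation, so declarative reflexivity is enough.
    rw [← h.sound hΓ hσ.plain hσ.sat]
    exact .refl ((hσ.interp.mono (h.scoped_solveExt hΓ).2.subDecl).dTypeWf hA)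
      (hσ.plain.nonPos h₁) (hσ.plain.nonNeg h₂)
  | @allL Γ Δ Θ κ A B a _ ha _ _ h ih =>
    have hΓ' := hΓ.marker_evar ha κ
    obtain ⟨h₁, h₂⟩ := h.scoped_solveExt hΓ'
    obtain ⟨σ', hσ', hagr, hτ⟩ := exists_solution h₂ h₁ hσ
    have hsub : Γ.SubDecl (.evar a κ :: .marker (.evar a) :: Γ) :=
      .of_subset (by simp +contextual)
    cases hA with
    | all hA' =>
      have ih := ih hΓ' ((hA'.mono hsub).opn (.evar List.mem_cons_self)) (hB.mono hsub) hσ'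
      -- `A` and `B` are well-formed over `Γ`, where `σ'` and `σ` agree; the witness is the value of
      -- `a` under `σ'`.
      rw [hσ'.plain.app_opn, hagr.app_typeWf hA', hagr.app_typeWf hB] at ih
      exact .allL hτ ih
  | @exR Γ Δ Θ κ A B a _ ha _ _ h ih =>
    have hΓ' := hΓ.marker_evar ha κ
    obtain ⟨h₁, h₂⟩ := h.scoped_solveExt hΓ'
    obtain ⟨σ', hσ', hagr, hτ⟩ := exists_solution h₂ h₁ hσ
    have hsub : Γ.SubDecl (.evar a κ :: .marker (.evar a) :: Γ) :=
      .of_subset (by simp +contextual)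
    cases hB with
    | ex hB' =>
      have ih := ih hΓ' (hA.mono hsub) ((hB'.mono hsub).opn (.evar List.mem_cons_self)) hσ'
      rw [hσ'.plain.app_opn, hagr.app_typeWf hB', hagr.app_typeWf hA] at ih
      exact .exR hτ ih
  | @allR Γ _ _ κ _ _ α hα hαA hαB h ih =>
    have hΓ' : Scoped (.uvar α κ :: Γ) := .uvar hΓ hα.1
    obtain ⟨h₁, h₂⟩ := h.scoped_solveExt hΓ'
    obtain ⟨β, σ', hβ, hβA, hβB, hσ', hA', hB', hα'⟩ :=
      exists_fresh_interpretation h₂ h₁ hαA hαB hσ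
    cases hB with
    | all hB =>
      have ih := ih hΓ' (hA.mono (.cons _ _))
        ((hB.mono (.cons _ _)).opn (.uvar List.mem_cons_self)) hσ'
      rw [hσ'.plain.app_opn, hA', hB', hα'] at ih
      exact .allR hβ hβA hβB ih
  | @exL Γ _ _ κ _ _ α hα hαA hαB h ih =>
    have hΓ' : Scoped (.uvar α κ :: Γ) := .uvar hΓ hα.1
    obtain ⟨h₁, h₂⟩ := h.scoped_solveExt hΓ'
    obtain ⟨β, σ', hβ, hβA, hβB, hσ', hA', hB', hα'⟩ :=
      exists_fresh_interpretation h₂ h₁ hαA hαB hσ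
    cases hA with
    | ex hA =>
      have ih := ih hΓ' ((hA.mono (.cons _ _)).opn (.uvar List.mem_cons_self))
        (hB.mono (.cons _ _)) hσ'
      rw [hσ'.plain.app_opn, hA', hB', hα'] at ih
      exact .exL hβ hβA hβB ih
  | posNegL _ h₁ h₂ ih =>
    -- A plain substitution never creates a leading quantifier, so the polarity side conditions
    -- carry over.
    exact .posNeg (ih hΓ hA hB hσ) (hσ.plain.nonPos h₁.nonPos) (hσ.plain.nonPos h₂)
  | posNegR _ h₁ h₂ ih =>
    exact .posNeg (ih hΓ hA hB hσ) (hσ.plain.nonPos h₁) (hσ.plain.nonPos h₂.nonPos)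
  | negPosL _ h₁ h₂ ih =>
    exact .negPos (ih hΓ hA hB hσ) (hσ.plain.nonNeg h₁.nonNeg) (hσ.plain.nonNeg h₂)
  | negPosR _ h₁ h₂ ih =>
    exact .negPos (ih hΓ hA hB hσ) (hσ.plain.nonNeg h₁) (hσ.plain.nonNeg h₂.nonNeg)

/-! ## The substitution given by a complete context -/

namespace Ty

theorem substE_of_notMem {a : ℕ} {u A : Ty} (h : a ∉ A.fev) : substE a u A = A := by
  induction A with
  | evar b =>
    have : b ≠ a := fun hb => h (by simp [fev, hb])
    simp [substE, this]
  | _ => simp_all [substE, fev]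

theorem substU_of_notMem {α : ℕ} {u A : Ty} (h : α ∉ A.fuv) : substU α u A = A := by
  induction A with
  | uvar β =>
    have : β ≠ α := fun hb => h (by simp [fuv, hb])
    simp [substU, this]
  | _ => simp_all [substU, fuv]

end Ty

/-- The substitution given by a context. -/
def Ctx.sub (Γ : Ctx) : Sub := ⟨fun α => Γ.apply (.uvar α), fun a => Γ.apply (.evar a)⟩

/-- Iterated substitution commutes with all type formers, so it is determined by its values on
variables. -/
theorem Ctx.sub_app (Γ : Ctx) (A : Ty) : Γ.sub.app A = Γ.apply A := by
  induction Γ generalizing A with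
  | nil => induction A <;> simp_all [Sub.app, Ctx.sub, Ctx.apply]
  | cons e Γ ih =>
    cases e with
    | solved a κ t =>
      rw [Ctx.apply, ← ih A]
      induction A <;> simp_all [Sub.app, Ctx.sub, Ctx.apply, Ty.substE]
    | eqn α t =>
      rw [Ctx.apply, ← ih A]
      induction A <;> simp_all [Sub.app, Ctx.sub, Ctx.apply, Ty.substU]
    | _ => exact ih A

theorem Ctx.apply_evar {Γ : Ctx} {a : ℕ} (h : ∀ κ t, Entry.solved a κ t ∉ Γ) :
    Γ.apply (.evar a) = .evar a := by
  induction Γ with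
  | nil => rfl
  | cons e Γ ih =>
    have ih := ih fun κ t h' => h κ t (List.mem_cons_of_mem _ h')
    cases e with
    | solved b κ t =>
      have : a ≠ b := fun hb => h κ t (by simp [hb])
      simp [Ctx.apply, ih, Ty.substE, this]
    | eqn α t => simp [Ctx.apply, ih, Ty.substU]
    | _ => exact ih

theorem Ctx.apply_uvar {Γ : Ctx} {α : ℕ} (h : ∀ t, Entry.eqn α t ∉ Γ) :
    Γ.apply (.uvar α) = .uvar α := by
  induction Γ with
  | nil => rfl
  | cons e Γ ih =>
    have ih := ih fun t h' => h t (List.mem_cons_of_mem _ h')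
    cases e with
    | solved b κ t => simp [Ctx.apply, ih, Ty.substE]
    | eqn β t =>
      have : α ≠ β := fun hb => h t (by simp [hb])
      simp [Ctx.apply, ih, Ty.substU, this]
    | _ => exact ih

/-! ### Eliminating a variable from a declarative context. -/

theorem DCtx.mem_subst {Ψ : DCtx} {α β : ℕ} {κ : Srt} {t : Ty} (hβ : β ≠ α)
    (h : DEntry.uvar β κ ∈ Ψ) : DEntry.uvar β κ ∈ DCtx.subst α t Ψ := by
  induction Ψ with
  | nil => simp at h
  | cons e Ψ ih =>
    cases e with
    | hyp x A p =>
      simp only [List.mem_cons, reduceCtorEq, false_or] at h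
      simpa [DCtx.subst] using ih h
    | uvar γ κ' =>
      simp only [List.mem_cons, DEntry.uvar.injEq] at h
      by_cases hγ : γ = α
      · simp only [DCtx.subst, hγ, if_true]
        grind
      · simp only [DCtx.subst, hγ, if_false, List.mem_cons, DEntry.uvar.injEq]
        grind

theorem DCtx.mem_of_mem_subst {Ψ : DCtx} {α β : ℕ} {κ : Srt} {t : Ty}
    (h : DEntry.uvar β κ ∈ DCtx.subst α t Ψ) : DEntry.uvar β κ ∈ Ψ := by
  induction Ψ with
  | nil => simp [DCtx.subst] at h
  | cons e Ψ ih =>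
    cases e with
    | hyp x A p =>
      simp only [DCtx.subst, List.mem_cons, reduceCtorEq, false_or] at h
      exact List.mem_cons_of_mem _ (ih h)
    | uvar γ κ' =>
      by_cases hγ : γ = α
      · simp only [DCtx.subst, hγ, if_true] at h
        exact List.mem_cons_of_mem _ h
      · simp only [DCtx.subst, hγ, if_false, List.mem_cons] at h ⊢
        exact h.imp id ih

theorem DSorting.subst_of_notMem {Ψ : DCtx} {bs : List Srt} {α : ℕ} {κ : Srt} {u t : Ty}
    (ht : DSorting Ψ bs t κ) (hα : α ∉ t.fuv) : DSorting (DCtx.subst α u Ψ) bs t κ := by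
  induction ht with
  | bvar h => exact .bvar h
  | uvar h => exact .uvar (DCtx.mem_subst (fun h' => hα (by simp [Ty.fuv, h'])) h)
  | unit => exact .unit
  | bin _ _ ih₁ ih₂ =>
    simp only [Ty.fuv, Finset.mem_union, not_or] at hα
    exact .bin (ih₁ hα.1) (ih₂ hα.2)
  | zero => exact .zero
  | succ _ ih => exact .succ (ih hα)

/-- Substitution removes the declaration of `α`. The term `u` that replaces it must remain
well-sorted afterwards, hence `hαu`. -/
theorem DSorting.substU {Ψ : DCtx} {bs : List Srt} {α : ℕ} {κ κ' : Srt} {u t : Ty}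
    (ht : DSorting Ψ bs t κ') (hα : ∀ κ', DEntry.uvar α κ' ∈ Ψ → κ' = κ)
    (hu : DSorting Ψ [] u κ) (hαu : α ∉ u.fuv) :
    DSorting (DCtx.subst α u Ψ) bs (Ty.substU α u t) κ' := by
  induction ht with
  | bvar h => exact .bvar h
  | @uvar β κ' h =>
    by_cases hβ : β = α
    · subst hβ
      rw [hα _ h]
      simpa [Ty.substU] using (hu.subst_of_notMem hαu).weaken_bound bs
    · simpa [Ty.substU, hβ] using DSorting.uvar (DCtx.mem_subst hβ h)
  | unit => exact .unit
  | bin _ _ ih₁ ih₂ => exact .bin ih₁ ih₂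
  | zero => exact .zero
  | succ _ ih => exact .succ ih

theorem Scoped.sort_unique {Γ : Ctx} (h : Scoped Γ) {α : ℕ} {κ κ' : Srt}
    (h₁ : Entry.uvar α κ ∈ Γ) (h₂ : Entry.uvar α κ' ∈ Γ) : κ = κ' := by
  induction h with
  | empty => simp at h₁
  | uvar _ hα ih =>
    rcases List.mem_cons.1 h₁ with h₁' | h₁' <;> rcases List.mem_cons.1 h₂ with h₂' | h₂'
    · cases h₁'; cases h₂'; rfl
    · cases h₁'; exact absurd ⟨_, h₂'⟩ hα
    · cases h₂'; exact absurd ⟨_, h₁'⟩ hα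
    · exact ih h₁' h₂'
  | _ => rename_i ih; exact ih (by simpa using h₁) (by simpa using h₂)

/-! ### The declarative context obtained from a complete extension. -/

theorem Extends.declaresE {Γ Δ : Ctx} (h : Extends Γ Δ) {a : ℕ} (ha : Γ.DeclaresE a) :
    Δ.DeclaresE a := by
  induction h with
  | id => exact ha
  | unsolved _ ih =>
    exact Ctx.declaresE_evar_cons.2 ((Ctx.declaresE_evar_cons.1 ha).imp _root_.id ih)
  | solved _ _ ih =>
    exact Ctx.declaresE_solved_cons.2 ((Ctx.declaresE_solved_cons.1 ha).imp _root_.id ih)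
  | solve _ ih =>
    exact Ctx.declaresE_solved_cons.2 ((Ctx.declaresE_evar_cons.1 ha).imp _root_.id ih)
  | add _ ih => exact (Ctx.SubDecl.cons _ _).declaresE (ih ha)
  | addSolved _ ih => exact (Ctx.SubDecl.cons _ _).declaresE (ih ha)
  | _ =>
    rename_i ih
    exact (Ctx.SubDecl.cons _ _).declaresE (ih (by simpa [Ctx.DeclaresE] using ha))

theorem applyCtx_solved {Ω Γ : Ctx} {a : ℕ} {κ : Srt} {t : Ty} (h : ¬ Γ.DeclaresE a) :
    applyCtx (.solved a κ t :: Ω) Γ = applyCtx Ω Γ := by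
  cases Γ with
  | nil => simp [applyCtx]
  | cons e Γ =>
    cases e with
    | evar b κ' =>
      have : ¬ (a = b ∧ κ = κ') := fun h' => h (.inl ⟨κ', by simp [h'.1]⟩)
      simp only [applyCtx, if_neg this]
    | solved b κ' t' =>
      have : ¬ (a = b ∧ κ = κ') := fun h' => h (.inr ⟨κ', t', by simp [h'.1]⟩)
      simp only [applyCtx, if_neg this]
    | _ => simp [applyCtx]

/-- Values over `Ψ` contain no existential variables, so the new solution leaves the old values
alone and gives `a` the value `[Ω]t`. -/
theorem Interp.solved {Ψ : DCtx} {Ω : Ctx} (h : Interp Ψ Ω.sub Ω) {a : ℕ} {κ : Srt} {t : Ty}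
    (ha : ¬ Ω.DeclaresE a) (ht : Sorting Ω [] t κ) :
    Interp Ψ (Ctx.sub (.solved a κ t :: Ω)) (.solved a κ t :: Ω) := by
  refine ⟨fun α κ' hα => ?_, fun b κ' hb => ?_⟩
  · have := h.1 α κ' (by simpa using hα)
    simp only [Ctx.sub, Ctx.apply]
    rwa [Ty.substE_of_notMem]
    have hf : (Ω.apply (.uvar α)).fev = ∅ := this.fev
    simp [hf]
  · by_cases hba : b = a
    · subst hba
      have hκ : κ' = κ := by
        rcases hb with hb | ⟨t', hb⟩
        · exact absurd (.inl ⟨κ', by simpa using hb⟩) ha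
        · rcases List.mem_cons.1 hb with hb | hb
          · cases hb; rfl
          · exact absurd (.inr ⟨κ', t', hb⟩) ha
      subst hκ
      have hb' : Ω.apply (.evar b) = .evar b :=
        Ctx.apply_evar fun κ t h' => ha (.inr ⟨κ, t, h'⟩)
      have := h.dSorting ht
      rw [Ctx.sub_app] at this
      simpa [Ctx.sub, Ctx.apply, hb', Ty.substE] using this
    · have := h.2 b κ' (by simpa [Ctx.HasE, hba] using hb)
      simp only [Ctx.sub, Ctx.apply]
      rwa [Ty.substE_of_notMem]
      have hf : (Ω.apply (.evar b)).fev = ∅ := this.fev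
      simp [hf]

/-- The clause comparing the declarations of `Ψ` and `Ω` strengthens the induction: in the equation
case it fixes the sort at which `Ψ` can declare `α`. -/
theorem Extends.exists_applyCtx {Δ Ω : Ctx} (h : Extends Δ Ω) (hΩ : CtxWf Ω) (hc : Ω.Complete) :
    ∃ Ψ, applyCtx Ω Δ = some Ψ ∧ (∀ α κ, DEntry.uvar α κ ∈ Ψ → Entry.uvar α κ ∈ Ω) ∧
      Interp Ψ Ω.sub Ω := by
  induction h with
  | id => exact ⟨[], by simp [applyCtx], by simp, by simp, by simp [Ctx.HasE]⟩
  | @hyp Γ Δ x A A' p _ hA ih =>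
    have hΩ' : CtxWf Δ := by cases hΩ <;> assumption
    obtain ⟨Ψ, h₁, h₂, h₃⟩ := ih hΩ' fun a κ h => hc a κ (List.mem_cons_of_mem _ h)
    refine ⟨.hyp x (Δ.apply A') p :: Ψ, by simp [applyCtx, hA, h₁], ?_,
      fun α κ hα => ?_, fun a κ ha => ?_⟩
    · intro α κ hα
      exact List.mem_cons_of_mem _ (h₂ α κ (by simpa using hα))
    · exact (h₃.1 α κ (by simpa using hα)).mono fun _ _ h => List.mem_cons_of_mem _ h
    · exact (h₃.2 a κ (by simpa [Ctx.HasE] using ha)).mono fun _ _ h => List.mem_cons_of_mem _ h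
  | @uvar Γ Δ α κ _ ih =>
    obtain ⟨hΩ', hα⟩ : CtxWf Δ ∧ ¬ Δ.DeclaresU α := by cases hΩ; exact ⟨‹_›, ‹_›⟩
    obtain ⟨Ψ, h₁, h₂, h₃⟩ := ih hΩ' fun a κ h => hc a κ (List.mem_cons_of_mem _ h)
    refine ⟨.uvar α κ :: Ψ, by simp [applyCtx, h₁], ?_, fun β κ' hβ => ?_, fun a κ' ha => ?_⟩
    · intro β κ' hβ
      simp only [List.mem_cons, DEntry.uvar.injEq, Entry.uvar.injEq] at hβ ⊢
      exact hβ.imp _root_.id (h₂ β κ')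
    · rcases List.mem_cons.1 hβ with hβ | hβ
      · cases hβ
        -- An equation for `α` presupposes an earlier declaration, so none can occur in the prefix.
        have : Δ.apply (.uvar α) = .uvar α := Ctx.apply_uvar fun t ht =>
          let ⟨κ, h, _⟩ := hΩ'.scoped.sorting_of_eqn ht
          hα ⟨κ, h⟩
        simp only [Ctx.sub, Ctx.apply, this]
        exact .uvar List.mem_cons_self
      · exact (h₃.1 β κ' hβ).mono fun _ _ h => List.mem_cons_of_mem _ h
    · exact (h₃.2 a κ' (by simpa [Ctx.HasE] using ha)).mono fun _ _ h => List.mem_cons_of_mem _ h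
  | @unsolved _ _ a κ => exact absurd List.mem_cons_self (hc a κ)
  | @add _ _ a κ => exact absurd List.mem_cons_self (hc a κ)
  | @solved Γ Δ a κ t t' _ _ ih =>
    obtain ⟨hΩ', ha, ht⟩ : CtxWf Δ ∧ ¬ Δ.DeclaresE a ∧ Sorting Δ [] t' κ := by
      cases hΩ; exact ⟨‹_›, ‹_›, ‹_›⟩
    obtain ⟨Ψ, h₁, h₂, h₃⟩ := ih hΩ' fun a κ h => hc a κ (List.mem_cons_of_mem _ h)
    exact ⟨Ψ, by simp [applyCtx, h₁], fun α κ h => List.mem_cons_of_mem _ (h₂ α κ h),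
      h₃.solved ha ht⟩
  | @solve Γ Δ a κ t' _ ih =>
    obtain ⟨hΩ', ha, ht⟩ : CtxWf Δ ∧ ¬ Δ.DeclaresE a ∧ Sorting Δ [] t' κ := by
      cases hΩ; exact ⟨‹_›, ‹_›, ‹_›⟩
    obtain ⟨Ψ, h₁, h₂, h₃⟩ := ih hΩ' fun a κ h => hc a κ (List.mem_cons_of_mem _ h)
    exact ⟨Ψ, by simp [applyCtx, h₁], fun α κ h => List.mem_cons_of_mem _ (h₂ α κ h),
      h₃.solved ha ht⟩
  | @addSolved Γ Δ a κ t' hext ih =>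
    obtain ⟨hΩ', ha, ht⟩ : CtxWf Δ ∧ ¬ Δ.DeclaresE a ∧ Sorting Δ [] t' κ := by
      cases hΩ; exact ⟨‹_›, ‹_›, ‹_›⟩
    obtain ⟨Ψ, h₁, h₂, h₃⟩ := ih hΩ' fun a κ h => hc a κ (List.mem_cons_of_mem _ h)
    refine ⟨Ψ, ?_, fun α κ h => List.mem_cons_of_mem _ (h₂ α κ h), h₃.solved ha ht⟩
    rw [applyCtx_solved fun h => ha (hext.declaresE h), h₁]
  | @eqn Γ Δ α t t' _ htt ih =>
    obtain ⟨hΩ', κ, hα, hne, ht, hαt⟩ : CtxWf Δ ∧ ∃ κ, Entry.uvar α κ ∈ Δ ∧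
        (∀ t', Entry.eqn α t' ∉ Δ) ∧ Sorting Δ [] t' κ ∧ α ∉ (Δ.apply t').fuv := by
      cases hΩ; exact ⟨‹_›, _, ‹_›, ‹_›, ‹_›, ‹_›⟩
    obtain ⟨Ψ, h₁, h₂, h₃⟩ := ih hΩ' fun a κ h => hc a κ (List.mem_cons_of_mem _ h)
    have hu := h₃.dSorting ht
    rw [Ctx.sub_app] at hu
    have hκ : ∀ κ', DEntry.uvar α κ' ∈ Ψ → κ' = κ := fun κ' h =>
      hΩ'.scoped.sort_unique (h₂ α κ' h) hα
    refine ⟨DCtx.subst α (Δ.apply t') Ψ, by simp [applyCtx, h₁, htt], ?_,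
      fun β κ' hβ => ?_, fun a κ' ha => ?_⟩
    · intro β κ' hβ
      exact List.mem_cons_of_mem _ (h₂ β κ' (DCtx.mem_of_mem_subst hβ))
    · exact (h₃.1 β κ' (by simpa using hβ)).substU hκ hu hαt
    · exact (h₃.2 a κ' (by simpa [Ctx.HasE] using ha)).substU hκ hu hαt
  | @marker Γ Δ m _ ih =>
    have hΩ' : CtxWf Δ := by cases hΩ <;> assumption
    obtain ⟨Ψ, h₁, h₂, h₃⟩ := ih hΩ' fun a κ h => hc a κ (List.mem_cons_of_mem _ h)
    refine ⟨Ψ, ?_, fun α κ h => List.mem_cons_of_mem _ (h₂ α κ h), fun α κ hα => ?_,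
      fun a κ ha => ?_⟩
    · cases m <;> simp [applyCtx, h₁]
    · exact h₃.1 α κ (by simpa using hα)
    · exact h₃.2 a κ (by simpa [Ctx.HasE] using ha)

/-! ### A well-formed context satisfies its own solutions and equations. -/

theorem Ctx.apply_cons_congr {Γ : Ctx} {A B : Ty} (h : Γ.apply A = Γ.apply B) (e : Entry) :
    Ctx.apply (e :: Γ) A = Ctx.apply (e :: Γ) B := by
  cases e <;> simp [Ctx.apply, h]

/-- At its own entry the equation sends `α`, which has no earlier equation, to `[Γ]t`, and
noncircularity keeps `[Γ]t` fixed. Later entries act equally on both sides. -/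
theorem CtxWf.apply_eqn {Ω : Ctx} (h : CtxWf Ω) {α : ℕ} {t : Ty} (ht : Entry.eqn α t ∈ Ω) :
    Ω.apply (.uvar α) = Ω.apply t := by
  induction h with
  | empty => simp at ht
  | @eqn Γ β κ u _ _ hne _ hu ih =>
    rcases List.mem_cons.1 ht with h' | h'
    · cases h'
      simp [Ctx.apply, Ctx.apply_uvar hne, Ty.substU_of_notMem hu, Ty.substU]
    · exact Ctx.apply_cons_congr (ih h') _
  | _ => rename_i ih; exact Ctx.apply_cons_congr (ih (by simpa using ht)) _

theorem Sorting.fev {Γ : Ctx} {bs : List Srt} {t : Ty} {κ : Srt} (h : Sorting Γ bs t κ) {a : ℕ}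
    (ha : a ∈ t.fev) : Γ.DeclaresE a := by
  induction h with
  | evar h => simp only [Ty.fev, Finset.mem_singleton] at ha; subst ha; exact .inl ⟨_, h⟩
  | solved h => simp only [Ty.fev, Finset.mem_singleton] at ha; subst ha; exact .inr ⟨_, _, h⟩
  | bin _ _ ih₁ ih₂ => exact (Finset.mem_union.1 ha).elim ih₁ ih₂
  | succ _ ih => exact ih ha
  | _ => simp [Ty.fev] at ha

namespace Ty

theorem fev_substE {a b : ℕ} {u A : Ty} (h : b ∈ (substE a u A).fev) : b ∈ u.fev ∨ b ∈ A.fev := by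
  induction A with
  | evar c =>
    by_cases hc : c = a
    · simp only [substE, hc, if_true] at h; exact .inl h
    · simp only [substE, hc, if_false] at h; exact .inr h
  | _ => simp only [substE, fev, Finset.mem_union] at h ⊢; grind

theorem fev_substU {α b : ℕ} {u A : Ty} (h : b ∈ (substU α u A).fev) : b ∈ u.fev ∨ b ∈ A.fev := by
  induction A with
  | uvar c =>
    by_cases hc : c = α
    · simp only [substU, hc, if_true] at h; exact .inl h
    · simp only [substU, hc, if_false] at h; exact .inr h
  | _ => simp only [substU, fev, Finset.mem_union] at h ⊢; grind

end Ty

theorem Scoped.fev_apply {Γ : Ctx} (h : Scoped Γ) {A : Ty} {b : ℕ} (hb : b ∈ (Γ.apply A).fev) :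
    b ∈ A.fev ∨ Γ.DeclaresE b := by
  induction h generalizing A with
  | empty => exact .inl hb
  | @solved Γ a κ t _ _ ht ih =>
    rw [Ctx.declaresE_solved_cons]
    rcases Ty.fev_substE hb with hb | hb
    · exact .inr (.inr ((ih hb).elim ht.fev id))
    · exact (ih hb).imp id .inr
  | @eqn Γ α κ t _ _ ht ih =>
    have hsub := Ctx.SubDecl.cons Γ (.eqn α t)
    rcases Ty.fev_substU hb with hb | hb
    · exact .inr (hsub.declaresE ((ih hb).elim ht.fev id))
    · exact (ih hb).imp id hsub.declaresE
  | _ => rename_i ih; exact (ih hb).imp id (Ctx.SubDecl.cons _ _).declaresE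

/-- Unlike equations, solutions need no separate noncircularity condition: `[Γ]t` contains only
existential variables declared earlier, hence not `a`. -/
theorem Scoped.apply_solved {Γ : Ctx} (h : Scoped Γ) {a : ℕ} {κ : Srt} {t : Ty}
    (ht : Entry.solved a κ t ∈ Γ) : Γ.apply (.evar a) = Γ.apply t := by
  induction h with
  | empty => simp at ht
  | @solved Γ b κ' u hΓ hb hu ih =>
    rcases List.mem_cons.1 ht with h' | h'
    · cases h'
      have h₁ : Γ.apply (.evar a) = .evar a := Ctx.apply_evar fun κ t h' => hb (.inr ⟨κ, t, h'⟩)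
      have h₂ : a ∉ (Γ.apply t).fev := fun h' => hb ((hΓ.fev_apply h').elim hu.fev id)
      simp [Ctx.apply, h₁, Ty.substE_of_notMem h₂, Ty.substE]
    · exact Ctx.apply_cons_congr (ih h') _
  | _ => rename_i ih; exact Ctx.apply_cons_congr (ih (by simpa using ht)) _

theorem CtxWf.sub_sat {Γ : Ctx} (h : CtxWf Γ) : Γ.sub.Sat Γ :=
  ⟨fun _ _ t ht => (h.scoped.apply_solved ht).trans (Γ.sub_app t).symm,
    fun _ t ht => (h.apply_eqn ht).trans (Γ.sub_app t).symm⟩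

/-- A variable that `Ω` changes is declared in `Ω`, so its value is a declarative term; every other
undeclared or equation-free variable is its own value. -/
theorem Interp.sub_plain {Ψ : DCtx} {Ω : Ctx} (hΩ : Scoped Ω) (h : Interp Ψ Ω.sub Ω) :
    Ω.sub.Plain := by
  refine ⟨fun α => ?_, fun a => ?_⟩
  · by_cases hα : ∃ t, Entry.eqn α t ∈ Ω
    · obtain ⟨t, ht⟩ := hα
      obtain ⟨κ, hκ, -⟩ := hΩ.sorting_of_eqn ht
      exact (h.1 α κ hκ).plain
    · simp only [Ctx.sub, Ctx.apply_uvar (not_exists.1 hα)]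
      exact .uvar α
  · by_cases ha : Ω.DeclaresE a
    · obtain ⟨κ, hκ⟩ := ha.hasE
      exact (h.2 a κ hκ).plain
    · simp only [Ctx.sub, Ctx.apply_evar fun κ t ht => ha (.inr ⟨κ, t, ht⟩)]
      exact .evar a

/-- `Ω` has the declarations, solutions and equations of `Δ`, up to applying `Ω`. -/
structure Ctx.Refines (Ω Δ : Ctx) : Prop where
  uvar : ∀ α κ, Entry.uvar α κ ∈ Δ → Entry.uvar α κ ∈ Ω
  evar : ∀ a κ, Entry.evar a κ ∈ Δ → Ω.HasE a κ
  solved : ∀ a κ t, Entry.solved a κ t ∈ Δ →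
    ∃ t', Entry.solved a κ t' ∈ Ω ∧ Ω.apply t = Ω.apply t'
  eqn : ∀ α t, Entry.eqn α t ∈ Δ → ∃ t', Entry.eqn α t' ∈ Ω ∧ Ω.apply t = Ω.apply t'

theorem Ctx.Refines.cons {Ω Δ : Ctx} (h : Ω.Refines Δ) (e : Entry) : Ctx.Refines (e :: Ω) Δ := by
  obtain ⟨h₁, h₂, h₃, h₄⟩ := h
  refine ⟨fun α κ h => List.mem_cons_of_mem _ (h₁ α κ h),
    fun a κ h => (Ctx.SubDecl.cons Ω e).2 _ _ (h₂ a κ h), fun a κ t h => ?_, fun α t h => ?_⟩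
  · obtain ⟨t', h, h'⟩ := h₃ a κ t h
    exact ⟨t', List.mem_cons_of_mem _ h, Ctx.apply_cons_congr h' e⟩
  · obtain ⟨t', h, h'⟩ := h₄ α t h
    exact ⟨t', List.mem_cons_of_mem _ h, Ctx.apply_cons_congr h' e⟩

theorem Extends.refines {Δ Ω : Ctx} (h : Extends Δ Ω) : Ω.Refines Δ := by
  induction h with
  | id => exact ⟨by simp, by simp, by simp, by simp⟩
  | add _ ih => exact ih.cons _
  | addSolved _ ih => exact ih.cons _
  | @hyp _ _ x A A' p _ _ ih =>
    obtain ⟨h₁, h₂, h₃, h₄⟩ := ih.cons (.hyp x A' p)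
    exact ⟨by simpa using h₁, by simpa using h₂, by simpa using h₃, by simpa using h₄⟩
  | @marker _ _ m _ ih =>
    obtain ⟨h₁, h₂, h₃, h₄⟩ := ih.cons (.marker m)
    exact ⟨by simpa using h₁, by simpa using h₂, by simpa using h₃, by simpa using h₄⟩
  | @uvar _ _ α κ _ ih =>
    obtain ⟨h₁, h₂, h₃, h₄⟩ := ih.cons (.uvar α κ)
    refine ⟨fun β κ' h => ?_, by simpa using h₂, by simpa using h₃, by simpa using h₄⟩
    exact (List.mem_cons.1 h).elim (fun h => h ▸ List.mem_cons_self) (h₁ β κ')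
  | @unsolved _ _ a κ _ ih =>
    obtain ⟨h₁, h₂, h₃, h₄⟩ := ih.cons (.evar a κ)
    refine ⟨by simpa using h₁, fun b κ' h => ?_, by simpa using h₃, by simpa using h₄⟩
    exact (List.mem_cons.1 h).elim (fun h => .inl (h ▸ List.mem_cons_self)) (h₂ b κ')
  | @solve _ _ a κ t _ ih =>
    obtain ⟨h₁, h₂, h₃, h₄⟩ := ih.cons (.solved a κ t)
    refine ⟨by simpa using h₁, fun b κ h => ?_, by simpa using h₃, by simpa using h₄⟩
    rcases List.mem_cons.1 h with h | h
    · cases h; exact .inr ⟨t, List.mem_cons_self⟩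
    · exact h₂ b _ h
  | @solved _ _ a κ t t' _ ht ih =>
    obtain ⟨h₁, h₂, h₃, h₄⟩ := ih.cons (.solved a κ t')
    refine ⟨by simpa using h₁, by simpa using h₂, fun b κ s h => ?_, by simpa using h₄⟩
    rcases List.mem_cons.1 h with h | h
    · cases h; exact ⟨t', List.mem_cons_self, Ctx.apply_cons_congr ht _⟩
    · exact h₃ b _ s h
  | @eqn _ _ α t t' _ ht ih =>
    obtain ⟨h₁, h₂, h₃, h₄⟩ := ih.cons (.eqn α t')
    refine ⟨by simpa using h₁, by simpa using h₂, by simpa using h₃, fun β s h => ?_⟩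
    rcases List.mem_cons.1 h with h | h
    · cases h; exact ⟨t', List.mem_cons_self, Ctx.apply_cons_congr ht _⟩
    · exact h₄ β s h

/-- If `Δ` solves `a` by `t`, then `Ω` solves it by some `t'` with `[Ω]t' = [Ω]t`, and `Ω` satisfies
its own solutions, so `[Ω]a = [Ω]t`. Equations behave in the same way. -/
theorem Extends.models {Ψ : DCtx} {Δ Ω : Ctx} (h : Extends Δ Ω) (hΩ : CtxWf Ω)
    (hi : Interp Ψ Ω.sub Ω) : Models Ψ Ω.sub Δ := by
  obtain ⟨h₁, h₂, h₃, h₄⟩ := h.refines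
  refine ⟨hi.sub_plain hΩ.scoped, hi.mono ⟨h₁, fun a κ ha => ?_⟩, fun a κ t ht => ?_,
    fun α t ht => ?_⟩
  · rcases ha with ha | ⟨t, ha⟩
    · exact h₂ a κ ha
    · exact let ⟨t', h, _⟩ := h₃ a κ t ha; .inr ⟨t', h⟩
  · obtain ⟨t', h, h'⟩ := h₃ a κ t ht
    rw [hΩ.sub_sat.1 a κ t' h, Ctx.sub_app, Ctx.sub_app, h']
  · obtain ⟨t', h, h'⟩ := h₄ α t ht
    rw [hΩ.sub_sat.2 α t' h, Ctx.sub_app, Ctx.sub_app, h']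

end BidirSub

theorem mainTheorem3 (pol : Polarity) (Γ Δ Ω : Ctx) (A B : Ty)
    (hΓ : CtxWf Γ) (hΔ : CtxWf Δ) (hΩ : CtxWf Ω) (hΩc : Ω.Complete)
    (hΓA : Γ.apply A = A) (hΓB : Γ.apply B = B)
    (hA : TypeWf Γ [] A) (hB : TypeWf Γ [] B)
    (hext : Extends Δ Ω) (hsub : AlgSub pol Γ A B Δ) :
    ∃ Ψ : DCtx, applyCtx Ω Δ = some Ψ ∧ DSub pol Ψ (Ω.apply A) (Ω.apply B) := by
  obtain ⟨Ψ, hΨ, -, hi⟩ := hext.exists_applyCtx hΩ hΩc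
  refine ⟨Ψ, hΨ, ?_⟩
  rw [← Ω.sub_app A, ← Ω.sub_app B]
  -- Soundness is applied to the model given by `Ω`.
  exact hsub.sound hΓ.scoped hA hB (hext.models hΩ hi)
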